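/- Let $\mathbb U$ be the open unit disc of $\mathbb C$ and $\hat{\mathbb C}$ the Riemann sphere, and let $\rho(z)=1/\bar z$ be inversion in the unit circle ($\rho(0)=\infty$, $\rho(\infty)=0$). Let $H^2$ be the Hilbert space of holomorphic functions $f(z)=\sum_{n\ge 0}\hat f(n)z^n$ on $\mathbb U$ with $\|f\|^2=\sum_n|\hat f(n)|^2<\infty$, with inner product $\langle f,g\rangle=\sum_n \hat f(n)\overline{\hat g(n)}$. Let $\varphi$ be a rational function that maps $\mathbb U$ into itself, of degree $d$ (the larger of the degrees of numerator and denominator in lowest terms), regarded also as a map $\hat{\mathbb C}\to\hat{\mathbb C}$. Let $\varphi_e=\rho\circ\varphi\circ\rho$. A point $w\in\hat{\mathbb C}$ is a regular value of $\varphi$ if $\varphi^{-1}(\{w\})$ has exactly $d$ distinct points, and a critical value otherwise. A branch of $\varphi_e^{-1}$ on $\mathbb U$ is the inverse $\mathbb U\to V$ of the restriction of $\varphi_e$ to some open set $V\subset\hat{\mathbb C}$ that $\varphi_e$ maps injectively onto $\mathbb U$. For functions $h,f$ on $\mathbb U$ and $\psi:\mathbb U\to\mathbb U$, write $M_hf=hf$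 and $C_\psi f=f\circ\psi$; let $B$ be the backward shift, $(Bf)(z)=(f(z)-f(0))/z$ for $z\ne0$ and $(Bf)(0)=f'(0)$. Put $(\Lambda_0f)(z)=f(0)/(1-\overline{\varphi(0)}\,z)$ and, if $\varphi(\infty)\in\mathbb U$, $(\Lambda_\infty f)(z)=f(0)/(1-\overline{\varphi(\infty)}\,z)$. Suppose that $\varphi$ is outer regular, i.e. all its critical values lie in $\mathbb U$. Then there are exactly $d$ distinct branches $\sigma_1,\dots,\sigma_d$ of $\varphi_e^{-1}$ on $\mathbb U$, each of them is a holomorphic map of $\mathbb U$ into $\mathbb U$, and: (a) each function $h_j(z)=z\sigma_j'(z)$ is holomorphic and bounded on $\mathbb U$; the operators $C_\varphi$, $\Lambda_0$, $B$, $M_{h_j}$ and $C_{\sigma_j}$ are all bounded on $H^2$; and $$C_\varphi^*=\Lambda_0+\sum_{j=1}^d M_{h_j}C_{\sigma_j}B\quad\text{on }H^2.$$ (b) If, in addition, $\varphi$ is strongly outer regular, i.e. $\varphi(\infty)\in\mathbb U$, then no $\sigma_j$ has a zero in $\mathbb U$; each function $g_j(z)=z\sigma_j'(z)/\sigma_j(z)$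 is holomorphic and bounded on $\mathbb U$; the operators $\Lambda_\infty$, $M_{g_j}$ and $C_{\sigma_j}$ are bounded on $H^2$; and $$C_\varphi^*=\Lambda_\infty+\sum_{j=1}^d M_{g_j}C_{\sigma_j}\quad\text{on }H^2.$$ -/

import Mathlib

open scoped Complex.UnitDisc

noncomputable section

namespace RatComp

/-! ### Holomorphic functions on the unit disc -/

/-- The extension by zero to `ℂ` of a function on the open unit disc. -/
def ext (F : 𝔻 → ℂ) : ℂ → ℂ := Function.extend (fun z : 𝔻 => (z : ℂ)) F 0

theorem ext_coe (F : 𝔻 → ℂ) (z : 𝔻) : ext F (z : ℂ) = F z :=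
  Complex.UnitDisc.coe_injective.extend_apply F 0 z

/-- `F` is holomorphic on the open unit disc. -/
def HolomorphicOnDisc (F : 𝔻 → ℂ) : Prop :=
  DifferentiableOn ℂ (ext F) (Metric.ball 0 1)

/-- `F` is a bounded holomorphic function on the open unit disc. -/
def BoundedHolomorphic (F : 𝔻 → ℂ) : Prop :=
  HolomorphicOnDisc F ∧ ∃ K : ℝ, ∀ z : 𝔻, ‖F z‖ ≤ K

/-- The complex derivative at a point of the open unit disc. -/
def discDeriv (F : 𝔻 → ℂ) (z : 𝔻) : ℂ := deriv (ext F) (z : ℂ)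

/-- The `n`-th Maclaurin coefficient. -/
def coeff (F : 𝔻 → ℂ) (n : ℕ) : ℂ := iteratedDeriv n (ext F) 0 / (n.factorial : ℂ)

theorem ext_add (F G : 𝔻 → ℂ) : ext (F + G) = ext F + ext G := by
  have := Function.extend_add (fun z : 𝔻 => (z : ℂ)) F G 0 0
  simpa [ext] using this

theorem ext_smul (c : ℂ) (F : 𝔻 → ℂ) : ext (c • F) = c • ext F := by
  have := Function.extend_smul c (fun z : 𝔻 => (z : ℂ)) F 0
  simpa [ext] using this

theorem ext_zero : ext 0 = 0 := by
  have := ext_smul 0 0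
  simpa using this

theorem HolomorphicOnDisc.analyticAt {F : 𝔻 → ℂ} (hF : HolomorphicOnDisc F) :
    AnalyticAt ℂ (ext F) 0 :=
  DifferentiableOn.analyticAt hF (Metric.ball_mem_nhds 0 one_pos)

theorem coeff_add {F G : 𝔻 → ℂ} (hF : HolomorphicOnDisc F) (hG : HolomorphicOnDisc G) :
    coeff (F + G) = coeff F + coeff G := by
  funext n
  simp only [coeff, ext_add, Pi.add_apply]
  rw [iteratedDeriv_add hF.analyticAt.contDiffAt hG.analyticAt.contDiffAt, add_div]

theorem coeff_smul (c : ℂ) {F : 𝔻 → ℂ} : coeff (c • F) = c • coeff F := by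
  funext n
  simp only [coeff, ext_smul, Pi.smul_apply, smul_eq_mul]
  rw [iteratedDeriv_const_smul_field, smul_eq_mul, mul_div_assoc]

theorem coeff_zero : coeff 0 = 0 := by
  have := coeff_smul 0 (F := 0)
  simpa using this

/-- A holomorphic function on the disc is the sum of its Maclaurin series. -/
theorem HolomorphicOnDisc.hasSum {F : 𝔻 → ℂ} (hF : HolomorphicOnDisc F) (z : 𝔻) :
    HasSum (fun n => coeff F n * (z : ℂ) ^ n) (F z) := by
  have h := Complex.hasSum_taylorSeries_on_ball hF
    (z := (z : ℂ)) (mem_ball_zero_iff.2 z.norm_lt_one)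
  rw [ext_coe] at h
  have he : (fun n => coeff F n * (z : ℂ) ^ n) = fun n : ℕ =>
      ((n.factorial : ℂ)⁻¹ • ((z : ℂ) - 0) ^ n • iteratedDeriv n (ext F) 0) := by
    funext n
    simp only [coeff, sub_zero, smul_eq_mul]
    ring
  rw [he]
  exact h

/-! ### The Hardy space -/

/-- The functions holomorphic on the unit disc with square-summable Maclaurin coefficients. -/
def hardySubmodule : Submodule ℂ (𝔻 → ℂ) where
  carrier := {F | HolomorphicOnDisc F ∧ Memℓp (coeff F) 2}
  zero_mem' := by
    refine ⟨?_, ?_⟩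
    · rw [HolomorphicOnDisc, ext_zero]
      exact differentiableOn_const _
    · rw [coeff_zero]
      exact zero_memℓp
  add_mem' := by
    rintro F G ⟨hF, hF2⟩ ⟨hG, hG2⟩
    refine ⟨?_, ?_⟩
    · rw [HolomorphicOnDisc, ext_add]
      exact DifferentiableOn.add hF hG
    · rw [coeff_add hF hG]
      exact hF2.add hG2
  smul_mem' := by
    rintro c F ⟨hF, hF2⟩
    refine ⟨?_, ?_⟩
    · rw [HolomorphicOnDisc, ext_smul]
      exact DifferentiableOn.const_smul hF c
    · rw [coeff_smul]
      exact hF2.const_smul c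

/-- The Hardy space of the unit disc. A type synonym, so that its topology is the norm topology
defined below and not that of pointwise convergence. -/
def H2 : Type := hardySubmodule

instance : AddCommGroup H2 := inferInstanceAs (AddCommGroup hardySubmodule)

instance : Module ℂ H2 := inferInstanceAs (Module ℂ hardySubmodule)

instance : CoeFun H2 (fun _ => 𝔻 → ℂ) := ⟨fun f => f.1⟩

/-- The map that sends a function to the sequence of its Maclaurin coefficients. -/
def H2.toL2 : H2 →ₗ[ℂ] lp (fun _ : ℕ => ℂ) 2 where
  toFun f := ⟨coeff f.1, f.2.2⟩
  map_add' f g := by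
    ext n
    exact congrFun (coeff_add f.2.1 g.2.1) n
  map_smul' c f := by
    ext n
    exact congrFun (coeff_smul c (F := f.1)) n

theorem H2.toL2_apply (f : H2) (n : ℕ) : H2.toL2 f n = coeff f n := rfl

theorem H2.toL2_injective : Function.Injective H2.toL2 := by
  intro f g h
  apply Subtype.ext
  funext z
  have hf := f.2.1.hasSum z
  have hg := g.2.1.hasSum z
  have hc : coeff f.1 = coeff g.1 := congrArg (fun a : lp (fun _ : ℕ => ℂ) 2 => (a : ℕ → ℂ)) h
  rw [hc] at hf
  exact hf.unique hg

theorem H2.toL2_surjective : Function.Surjective H2.toL2 := by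
  intro a
  set p := FormalMultilinearSeries.ofScalars ℂ (fun n => a n) with hp
  have hr : (1 : ENNReal) ≤ p.radius := by
    have := p.le_radius_of_bound (r := 1) ‖a‖ (fun n => by
      simp only [NNReal.coe_one, one_pow, mul_one, hp]
      rw [FormalMultilinearSeries.ofScalars_norm]
      exact lp.norm_apply_le_norm two_ne_zero a n)
    simpa using this
  have hps : HasFPowerSeriesOnBall p.sum p 0 1 :=
    (p.hasFPowerSeriesOnBall (lt_of_lt_of_le one_pos hr)).mono one_pos hr
  let F : 𝔻 → ℂ := fun z => p.sum (z : ℂ)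
  have hEq : Set.EqOn (ext F) p.sum (Metric.ball 0 1) := by
    intro z hz
    exact ext_coe F (Complex.UnitDisc.mk z (mem_ball_zero_iff.1 hz))
  have hball : Metric.eball (0 : ℂ) 1 = Metric.ball 0 1 := by
    have := Metric.eball_coe (x := (0 : ℂ)) (ε := 1)
    simpa using this
  have hF : HolomorphicOnDisc F := by
    have h := hps.differentiableOn
    rw [hball] at h
    exact h.congr hEq
  have hco : coeff F = fun n => a n := by
    have h1 := hF.analyticAt.hasFPowerSeriesAt
    have h2 : HasFPowerSeriesAt (ext F) p 0 :=
      hps.hasFPowerSeriesAt.congr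
        (Filter.eventuallyEq_of_mem (Metric.ball_mem_nhds 0 one_pos) hEq).symm
    exact FormalMultilinearSeries.ofScalars_series_injective ℂ ℂ (h1.eq_formalMultilinearSeries h2)
  refine ⟨⟨F, hF, ?_⟩, ?_⟩
  · rw [hco]
    exact lp.memℓp a
  · ext n
    exact congrFun hco n

instance : NormedAddCommGroup H2 :=
  NormedAddCommGroup.induced H2 (lp (fun _ : ℕ => ℂ) 2) H2.toL2 H2.toL2_injective

instance : InnerProductSpace ℂ H2 := InnerProductSpace.induced H2.toL2

/-- The norm on the Hardy space is the `ℓ²` norm of the Maclaurin coefficients. -/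
theorem H2.norm_sq_eq (f : H2) : ‖f‖ ^ 2 = ∑' n, ‖coeff f n‖ ^ 2 := by
  have h := lp.norm_rpow_eq_tsum (p := 2) (by norm_num) (H2.toL2 f)
  have h2 : ‖f‖ = ‖H2.toL2 f‖ := rfl
  have h3 : ∀ n, (H2.toL2 f n : ℂ) = coeff f n := fun _ => rfl
  rw [h2]
  simpa [h3] using h

/-- The inner product on the Hardy space; Mathlib makes it conjugate-linear in the first variable. -/
theorem H2.inner_eq (f g : H2) :
    inner ℂ f g = ∑' n, coeff g n * (starRingEnd ℂ) (coeff f n) := rfl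

instance : CompleteSpace H2 := by
  have h : Isometry H2.toL2 := AddMonoidHomClass.isometry_of_norm H2.toL2 (fun _ => rfl)
  exact (h.isUniformInducing.completeSpace_congr H2.toL2_surjective).2 inferInstance

/-! ### Operators on functions, and bounded operators on the Hardy space -/

/-- The bounded operator `T` on the Hardy space is given by the formula `A`. -/
def Realizes (A : (𝔻 → ℂ) → (𝔻 → ℂ)) (T : H2 →L[ℂ] H2) : Prop :=
  ∀ f : H2, (T f : 𝔻 → ℂ) = A f

/-- Composition `f ↦ f ∘ ψ`. -/
def compOp (ψ : 𝔻 → 𝔻) (f : 𝔻 → ℂ) : 𝔻 → ℂ := fun z => f (ψ z)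

/-- Multiplication `f ↦ h f`. -/
def mulOp (h : 𝔻 → ℂ) (f : 𝔻 → ℂ) : 𝔻 → ℂ := fun z => h z * f z

open Classical in
/-- The backward shift. -/
def backwardShift (f : 𝔻 → ℂ) : 𝔻 → ℂ := fun z =>
  if z = 0 then discDeriv f 0 else (f z - f 0) / (z : ℂ)

/-- The rank-one formula `f ↦ f(0) / (1 - conj(a) z)`. -/
def rankOne (a : 𝔻) (f : 𝔻 → ℂ) : 𝔻 → ℂ := fun z =>
  f 0 / (1 - (starRingEnd ℂ) (a : ℂ) * (z : ℂ))

/-- The weight `z σ'(z)`. -/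
def weightH (σ : 𝔻 → 𝔻) : 𝔻 → ℂ := fun z =>
  (z : ℂ) * discDeriv (fun w => (σ w : ℂ)) z

/-- The weight `z σ'(z) / σ(z)`. -/
def weightG (σ : 𝔻 → 𝔻) : 𝔻 → ℂ := fun z =>
  (z : ℂ) * discDeriv (fun w => (σ w : ℂ)) z / (σ z : ℂ)

/-! ### Rational functions on the Riemann sphere -/

/-- The inclusion of the open unit disc into the Riemann sphere. -/
def toSphere (z : 𝔻) : OnePoint ℂ := ((z : ℂ) : OnePoint ℂ)

open Classical in
/-- The selfmap of the Riemann sphere given by a rational function (in lowest terms). -/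
def sphereMap (R : RatFunc ℂ) : OnePoint ℂ → OnePoint ℂ
  | none =>
    if R.denom.natDegree < R.num.natDegree then OnePoint.infty
    else ((R.num.coeff R.denom.natDegree / R.denom.leadingCoeff : ℂ) : OnePoint ℂ)
  | some z =>
    if R.denom.eval z = 0 then OnePoint.infty
    else ((R.num.eval z / R.denom.eval z : ℂ) : OnePoint ℂ)

/-- The degree of a rational function: the larger of the degrees of numerator and denominator. -/
def ratDegree (R : RatFunc ℂ) : ℕ := max R.num.natDegree R.denom.natDegree

open Classical in
/-- Inversion in the unit circle, `z ↦ 1 / conj(z)`. -/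
def inversion : OnePoint ℂ → OnePoint ℂ
  | none => ((0 : ℂ) : OnePoint ℂ)
  | some z => if z = 0 then OnePoint.infty else ((1 / (starRingEnd ℂ) z : ℂ) : OnePoint ℂ)

/-- The exterior map of a rational function. -/
def exteriorMap (R : RatFunc ℂ) : OnePoint ℂ → OnePoint ℂ :=
  inversion ∘ sphereMap R ∘ inversion

/-- `w` is a regular value of `R`: it has exactly `deg R` distinct preimages on the sphere. -/
def IsRegularValue (R : RatFunc ℂ) (w : OnePoint ℂ) : Prop :=
  (sphereMap R ⁻¹' {w}).encard = (ratDegree R : ℕ∞)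

/-- The rational functions that map the open unit disc into itself. -/
def RatU : Set (RatFunc ℂ) := {R | ∀ z : 𝔻, ∃ w : 𝔻, sphereMap R (toSphere z) = toSphere w}

/-- The selfmap of the disc given by a member of `RatU`. -/
def discMap (φ : RatU) (z : 𝔻) : 𝔻 := (φ.2 z).choose

theorem discMap_spec (φ : RatU) (z : 𝔻) :
    sphereMap φ.1 (toSphere z) = toSphere (discMap φ z) := (φ.2 z).choose_spec

/-- Outer regularity: all critical (that is, non-regular) values lie in the open unit disc. -/
def OuterRegular (R : RatFunc ℂ) : Prop :=
  ∀ w : OnePoint ℂ, ¬ IsRegularValue R w → ∃ z : 𝔻, w = toSphere z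

/-- `τ` is a branch of the inverse of `f` defined on the open unit disc: the inverse of the
restriction of `f` to some open set that `f` maps injectively onto the disc. -/
def IsInverseBranch (f : OnePoint ℂ → OnePoint ℂ) (τ : 𝔻 → OnePoint ℂ) : Prop :=
  ∃ V : Set (OnePoint ℂ), IsOpen V ∧ Set.InjOn f V ∧ f '' V = Set.range toSphere ∧
    ∀ z : 𝔻, τ z ∈ V ∧ f (τ z) = toSphere z

end RatComp

end

noncomputable section

namespace RatComp

/-! ### Integral means over circles and boundedness on the Hardy space -/

section HardySpace

open Real (circleAverage)
open Filter Topology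

/-! The adjoint is tested on the reproducing kernels `K_w(z) = 1 / (1 - conj(w) z)`, where `C_φ^*
K_w = K_{φ(w)}`; an operator with these values on all kernels must be the adjoint
(`adjoint_eq_of_kernel`).

Write the exterior map as `q / p` with polynomials of formal degree `d`. The `σ_j(z)` are the zeros
of `F_z = q - z p`, and `σ_j' = p(σ_j) / F_z'(σ_j)`. These are the residues of `p / F_z`, so partial
fractions (`sum_partialFraction`) express `∑ z σ_j'(z) / (u - σ_j(z))` as the value of `q / (q - z
p)` at `u` minus its value at `∞` (`sum_weightH`). At `u = 1 / conj(w)` the value of `q / (q - z p)`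
is `K_{φ(w)}(z)`; at `∞` it is `K_{φ(0)}(z)`, and at `0` it is `K_{φ(∞)}(z)`. Since `B K_w = conj(w)
K_w`, taking `u = 1 / conj(w)` gives (a). Combining it with `u = 0` gives (b).

Outer regularity makes each fibre of `q / p` over the closed disc consist of `d` simple finite
zeros. Over the open disc, `q / p` is therefore a proper local homeomorphism with finite fibres,
hence a covering. Since the disc is simply connected, the covering has `d` disjoint sections
(`exists_continuous_branches`), holomorphic by the inverse function theorem. Regularity on the unit
circle itself bounds the weights, by compactness (`exists_le_norm`). Composition operators are
bounded by Littlewood's subordination principle (`circleAverage_comp_le`). -/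

theorem HolomorphicOnDisc.continuousOn {F : 𝔻 → ℂ} (hF : HolomorphicOnDisc F) :
    ContinuousOn (ext F) (Metric.ball 0 1) :=
  DifferentiableOn.continuousOn hF

theorem ext_of_norm_lt (F : 𝔻 → ℂ) {z : ℂ} (hz : ‖z‖ < 1) :
    ext F z = F (Complex.UnitDisc.mk z hz) :=
  ext_coe F (Complex.UnitDisc.mk z hz)

/-- Functions of the form `z ↦ g z` with `g` differentiable on the unit ball are holomorphic. -/
theorem holomorphicOnDisc_of_eq {F : 𝔻 → ℂ} {g : ℂ → ℂ}
    (hg : DifferentiableOn ℂ g (Metric.ball 0 1)) (h : ∀ z : 𝔻, F z = g z) :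
    HolomorphicOnDisc F :=
  hg.congr fun z hz => by
    rw [ext_of_norm_lt F (mem_ball_zero_iff.1 hz), h]
    rfl

theorem HolomorphicOnDisc.mul {F G : 𝔻 → ℂ} (hF : HolomorphicOnDisc F)
    (hG : HolomorphicOnDisc G) : HolomorphicOnDisc (fun z => F z * G z) :=
  holomorphicOnDisc_of_eq (DifferentiableOn.mul hF hG) fun z => by simp [ext_coe]

theorem HolomorphicOnDisc.comp {F : 𝔻 → ℂ} {ψ : 𝔻 → 𝔻} (hF : HolomorphicOnDisc F)
    (hψ : HolomorphicOnDisc (fun z => (ψ z : ℂ))) : HolomorphicOnDisc (fun z => F (ψ z)) :=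
  holomorphicOnDisc_of_eq (g := ext F ∘ ext (fun z => (ψ z : ℂ)))
    (DifferentiableOn.comp hF hψ fun z hz => by
      rw [ext_of_norm_lt _ (mem_ball_zero_iff.1 hz)]
      exact mem_ball_zero_iff.2 (Complex.UnitDisc.norm_lt_one _))
    fun z => by simp [ext_coe]

theorem norm_circleMap_zero_lt {r : ℝ} (hr0 : 0 ≤ r) (hr : r < 1) (θ : ℝ) :
    ‖circleMap 0 r θ‖ < 1 := by
  rw [norm_circleMap_zero, abs_of_nonneg hr0]
  exact hr

theorem HolomorphicOnDisc.continuous_circleMap {F : 𝔻 → ℂ} (hF : HolomorphicOnDisc F) {r : ℝ}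
    (hr0 : 0 ≤ r) (hr : r < 1) : Continuous fun θ => ext F (circleMap 0 r θ) :=
  hF.continuousOn.comp_continuous (_root_.continuous_circleMap 0 r) fun θ =>
    mem_ball_zero_iff.2 (norm_circleMap_zero_lt hr0 hr θ)

/-- Parseval's identity for the circle of radius `r` about the origin. -/
theorem HolomorphicOnDisc.hasSum_circleAverage {F : 𝔻 → ℂ} (hF : HolomorphicOnDisc F) {r : ℝ}
    (hr0 : 0 ≤ r) (hr : r < 1) :
    HasSum (fun n => ‖coeff F n‖ ^ 2 * r ^ (2 * n))
      (circleAverage (fun z => ‖ext F z‖ ^ 2) 0 r) := by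
  rw [hasSum_iff_tendsto_nat_of_nonneg (fun n => by positivity)]
  -- The radius is absorbed into the coefficients, so that the polynomial Parseval identity on the
  -- unit circle applies.
  let p : ℕ → Polynomial ℂ := fun N =>
    ∑ n ∈ Finset.range N, Polynomial.C (coeff F n * (r : ℂ) ^ n) * Polynomial.X ^ n
  have hpc : ∀ N i, (p N).coeff i = if i < N then coeff F i * (r : ℂ) ^ i else 0 := by
    intro N i
    simp only [p, Polynomial.finsetSum_coeff, Polynomial.coeff_C_mul, Polynomial.coeff_X_pow]
    simp
  have hpe : ∀ N z, (p N).eval z = ∑ n ∈ Finset.range N, coeff F n * (r * z) ^ n := by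
    intro N z
    simp [p, Polynomial.eval_finsetSum, mul_pow, mul_assoc]
  have hps : ∀ N, ∑ n ∈ Finset.range N, ‖coeff F n‖ ^ 2 * r ^ (2 * n) =
      circleAverage (fun z => ‖(p N).eval z‖ ^ 2) 0 1 := by
    intro N
    rw [← Polynomial.sum_sq_norm_coeff_eq_circleAverage]
    symm
    rw [Finset.sum_subset (s₂ := Finset.range N)]
    · refine Finset.sum_congr rfl fun n hn => ?_
      rw [hpc, if_pos (Finset.mem_range.1 hn), norm_mul, norm_pow, Complex.norm_real,
        Real.norm_of_nonneg hr0]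
      ring
    · intro i hi
      by_contra h
      exact (Polynomial.mem_support_iff.1 hi) (by rw [hpc, if_neg (by simpa using h)])
    · intro i _ hi
      simp [Polynomial.notMem_support_iff.1 hi]
  simp_rw [hps]
  rw [Real.circleAverage_eq_circleAverage_zero_one]
  have hlt : ∀ θ, ‖(r : ℂ) * circleMap 0 1 θ‖ < 1 := by
    intro θ
    simpa [abs_of_nonneg hr0] using hr
  have hsum : ∀ θ, HasSum (fun n => coeff F n * (r * circleMap 0 1 θ) ^ n)
      (ext F (r * circleMap 0 1 θ)) := by
    intro θ
    rw [ext_of_norm_lt F (hlt θ)]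
    exact hF.hasSum (Complex.UnitDisc.mk _ (hlt θ))
  -- The norms of the terms do not depend on the angle, so their sum at angle `0` dominates all
  -- partial sums on the circle.
  have hM := (hsum 0).summable.norm
  set M := ∑' n, ‖coeff F n * (r * circleMap 0 1 0) ^ n‖ with hMdef
  have hb : ∀ N θ, ‖(p N).eval (circleMap 0 1 θ)‖ ≤ M := by
    intro N θ
    rw [hpe]
    refine (norm_sum_le _ _).trans ?_
    refine le_trans (le_of_eq ?_) (hM.sum_le_tsum (Finset.range N) fun _ _ => norm_nonneg _)
    exact Finset.sum_congr rfl fun n _ => by simp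
  simp only [circleAverage]
  refine Tendsto.const_smul ?_ _
  refine intervalIntegral.tendsto_integral_filter_of_dominated_convergence (fun _ => M ^ 2)
    ?_ ?_ ?_ ?_
  · exact Eventually.of_forall fun N => by
      refine Continuous.aestronglyMeasurable ?_
      fun_prop
  · refine Eventually.of_forall fun N => Eventually.of_forall fun θ _ => ?_
    rw [norm_pow, norm_norm]
    exact pow_le_pow_left₀ (norm_nonneg _) (hb N θ) 2
  · exact intervalIntegrable_const
  · refine Eventually.of_forall fun θ _ => ?_
    simp only [hpe, add_zero]
    exact ((hsum θ).tendsto_sum_nat.norm).pow 2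

theorem H2.holomorphic (f : H2) : HolomorphicOnDisc f := f.2.1

theorem H2.ext_fun {f g : H2} (h : ∀ z, f z = g z) : f = g := Subtype.ext (funext h)

theorem H2.summable_norm_sq (f : H2) : Summable fun n => ‖coeff f n‖ ^ 2 := by
  have := (memℓp_gen_iff (p := 2) (by norm_num)).1 f.2.2
  simpa using this

theorem H2.circleAverage_le (f : H2) {r : ℝ} (hr0 : 0 ≤ r) (hr : r < 1) :
    circleAverage (fun z => ‖ext f z‖ ^ 2) 0 r ≤ ‖f‖ ^ 2 := by
  have h := f.holomorphic.hasSum_circleAverage hr0 hr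
  rw [← h.tsum_eq, H2.norm_sq_eq]
  refine h.summable.tsum_le_tsum (fun n => ?_) f.summable_norm_sq
  exact mul_le_of_le_one_right (by positivity) (pow_le_one₀ hr0 hr.le)

/-- Parseval bounds each finite sum with weights `r ^ (2 * n)`, and then `r → 1`. Only radii near
`1` matter, and `r₀` records this: the backward shift is estimated away from the origin. -/
theorem HolomorphicOnDisc.sum_le_of_circleAverage_le {F : 𝔻 → ℂ} (hF : HolomorphicOnDisc F)
    {K r₀ : ℝ} (hr₀ : r₀ < 1)
    (h : ∀ r, r₀ ≤ r → 0 ≤ r → r < 1 → circleAverage (fun z => ‖ext F z‖ ^ 2) 0 r ≤ K)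
    (s : Finset ℕ) : ∑ n ∈ s, ‖coeff F n‖ ^ 2 ≤ K := by
  have hlim : Tendsto (fun r : ℝ => ∑ n ∈ s, ‖coeff F n‖ ^ 2 * r ^ (2 * n)) (𝓝[<] 1)
      (𝓝 (∑ n ∈ s, ‖coeff F n‖ ^ 2)) := by
    have hc : Continuous fun r : ℝ => ∑ n ∈ s, ‖coeff F n‖ ^ 2 * r ^ (2 * n) := by fun_prop
    have := (hc.tendsto 1).mono_left (nhdsWithin_le_nhds (s := Set.Iio 1))
    simpa using this
  refine le_of_tendsto hlim ?_
  filter_upwards [Ioo_mem_nhdsLT (show max r₀ 0 < (1 : ℝ) by simp [hr₀])] with r hr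
  have h0 : 0 ≤ r := (le_max_right _ _).trans hr.1.le
  refine le_trans ?_ (h r ((le_max_left _ _).trans hr.1.le) h0 hr.2)
  have hs := hF.hasSum_circleAverage h0 hr.2
  rw [← hs.tsum_eq]
  exact hs.summable.sum_le_tsum s fun n _ => by positivity

theorem HolomorphicOnDisc.memℓp_of_circleAverage_le {F : 𝔻 → ℂ} (hF : HolomorphicOnDisc F)
    {K r₀ : ℝ} (hr₀ : r₀ < 1)
    (h : ∀ r, r₀ ≤ r → 0 ≤ r → r < 1 → circleAverage (fun z => ‖ext F z‖ ^ 2) 0 r ≤ K) :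
    Memℓp (coeff F) 2 := by
  rw [memℓp_gen_iff (by norm_num)]
  have := summable_of_sum_le (fun n => by positivity) (hF.sum_le_of_circleAverage_le hr₀ h)
  simpa using this

/-- An additive and homogeneous formula that maps the Hardy space to holomorphic functions, with a
bound on integral means, is realized by a bounded operator. -/
theorem exists_realizes {A : (𝔻 → ℂ) → (𝔻 → ℂ)}
    (hadd : ∀ f g : H2, A (f + g : H2) = A f + A g)
    (hsmul : ∀ (c : ℂ) (f : H2), A (c • f : H2) = c • A f)
    (hA : ∀ f : H2, HolomorphicOnDisc (A f)) {K r₀ : ℝ} (hK : 0 ≤ K) (hr₀ : r₀ < 1)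
    (h : ∀ (f : H2) (r : ℝ), r₀ ≤ r → 0 ≤ r → r < 1 →
      circleAverage (fun z => ‖ext (A f) z‖ ^ 2) 0 r ≤ K * ‖f‖ ^ 2) :
    ∃ T : H2 →L[ℂ] H2, Realizes A T := by
  let T₀ : H2 →ₗ[ℂ] H2 :=
    { toFun := fun f => ⟨A f, hA f, (hA f).memℓp_of_circleAverage_le hr₀ (h f)⟩
      map_add' := fun f g => Subtype.ext (hadd f g)
      map_smul' := fun c f => Subtype.ext (hsmul c f) }
  refine ⟨T₀.mkContinuous (√K) fun f => ?_, fun f => rfl⟩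
  refine abs_le_of_sq_le_sq' ?_ (by positivity) |>.2
  rw [mul_pow, Real.sq_sqrt hK, H2.norm_sq_eq]
  exact Real.tsum_le_of_sum_le (fun n => by positivity)
    ((hA f).sum_le_of_circleAverage_le hr₀ (h f))

theorem H2.add_apply (f g : H2) (z : 𝔻) : (f + g : H2) z = f z + g z := rfl

theorem H2.smul_apply (c : ℂ) (f : H2) (z : 𝔻) : (c • f : H2) z = c * f z := rfl

theorem H2.sum_apply {ι : Type*} (s : Finset ι) (f : ι → H2) (z : 𝔻) :
    (∑ i ∈ s, f i : H2) z = ∑ i ∈ s, f i z := by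
  classical
  induction s using Finset.induction_on with
  | empty => rfl
  | insert a s ha ih => rw [Finset.sum_insert ha, Finset.sum_insert ha, H2.add_apply, ih]

end HardySpace

/-! ### The individual operators and the reproducing kernels -/

section Operators

open Real (circleAverage)
open Filter Topology

theorem HolomorphicOnDisc.circleIntegrable {F : 𝔻 → ℂ} (hF : HolomorphicOnDisc F) {r : ℝ}
    (hr0 : 0 ≤ r) (hr : r < 1) : CircleIntegrable (fun z => ‖ext F z‖ ^ 2) 0 r :=
  (((hF.continuous_circleMap hr0 hr).norm).pow 2).intervalIntegrable _ _

/-! ### Multiplication operators and the backward shift -/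

theorem circleAverage_mul_le {h : 𝔻 → ℂ} (hh : HolomorphicOnDisc h) {K : ℝ}
    (hK : ∀ z, ‖h z‖ ≤ K) (f : H2) {r : ℝ} (hr0 : 0 ≤ r) (hr : r < 1) :
    circleAverage (fun z => ‖ext (mulOp h f) z‖ ^ 2) 0 r ≤ K ^ 2 * ‖f‖ ^ 2 := by
  calc circleAverage (fun z => ‖ext (mulOp h f) z‖ ^ 2) 0 r
      ≤ circleAverage (fun z => K ^ 2 • ‖ext f z‖ ^ 2) 0 r := by
        refine Real.circleAverage_mono ((hh.mul f.holomorphic).circleIntegrable hr0 hr)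
          ((f.holomorphic.circleIntegrable hr0 hr).const_fun_smul) fun z hz => ?_
        have hz1 : ‖z‖ < 1 := by
          rw [mem_sphere_zero_iff_norm.1 hz, abs_of_nonneg hr0]
          exact hr
        rw [ext_of_norm_lt _ hz1, ext_of_norm_lt _ hz1, mulOp, norm_mul, mul_pow, smul_eq_mul]
        gcongr
        exact hK _
    _ = K ^ 2 * circleAverage (fun z => ‖ext f z‖ ^ 2) 0 r := by
        rw [Real.circleAverage_fun_smul, smul_eq_mul]
    _ ≤ K ^ 2 * ‖f‖ ^ 2 := by
        gcongr
        exact f.circleAverage_le hr0 hr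

theorem exists_realizes_mulOp {h : 𝔻 → ℂ} (hh : BoundedHolomorphic h) :
    ∃ T : H2 →L[ℂ] H2, Realizes (mulOp h) T := by
  obtain ⟨hh, K, hK⟩ := hh
  refine exists_realizes (K := K ^ 2) (r₀ := 0) ?_ ?_ (fun f => hh.mul f.holomorphic)
    (by positivity) one_pos fun f r _ hr0 hr => circleAverage_mul_le hh hK f hr0 hr
  · intro f g
    funext z
    simp only [mulOp, H2.add_apply, Pi.add_apply, mul_add]
  · intro c f
    funext z
    simp only [mulOp, H2.smul_apply, Pi.smul_apply, smul_eq_mul]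
    ring

/-- Gives holomorphy at the origin through the removable singularity theorem for `dslope`. -/
theorem backwardShift_eq_dslope (f : 𝔻 → ℂ) (z : 𝔻) :
    backwardShift f z = dslope (ext f) 0 z := by
  by_cases hz : z = 0
  · simp [backwardShift, hz, discDeriv]
  · rw [backwardShift, if_neg hz, dslope_of_ne _ (by simpa using hz), slope_def_field, ext_coe,
      sub_zero]
    congr 2
    exact (ext_coe f 0).symm

theorem HolomorphicOnDisc.backwardShift {f : 𝔻 → ℂ} (hf : HolomorphicOnDisc f) :
    HolomorphicOnDisc (backwardShift f) :=
  holomorphicOnDisc_of_eq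
    ((Complex.differentiableOn_dslope (Metric.ball_mem_nhds 0 one_pos)).2 hf)
    (backwardShift_eq_dslope f)

theorem coe_mul_backwardShift (f : 𝔻 → ℂ) (z : 𝔻) :
    (z : ℂ) * backwardShift f z = f z - f 0 := by
  by_cases hz : z = 0
  · simp [hz]
  · rw [backwardShift, if_neg hz, mul_div_cancel₀ _ (by simpa using hz)]

theorem H2.norm_apply_zero_le (f : H2) : ‖f 0‖ ^ 2 ≤ ‖f‖ ^ 2 := by
  have h := f.circleAverage_le le_rfl one_pos
  rw [Real.circleAverage_zero] at h
  rwa [← ext_coe f 0]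

theorem exists_realizes_backwardShift : ∃ T : H2 →L[ℂ] H2, Realizes backwardShift T := by
  -- For `|z| ≥ 1/2`, `|Bf| ≤ 2 (|f| + |f(0)|)`, so `|Bf|² ≤ 8 (|f|² + |f(0)|²)`. Both the mean of
  -- `|f|²` and `|f(0)|²` are at most `‖f‖²`, whence `16`.
  refine exists_realizes (K := 16) (r₀ := 1 / 2) ?_ ?_
    (fun f => f.holomorphic.backwardShift) (by norm_num) (by norm_num) ?_
  · intro f g
    have h0 : DifferentiableAt ℂ (ext f) 0 := f.holomorphic.analyticAt.differentiableAt
    have h1 : DifferentiableAt ℂ (ext g) 0 := g.holomorphic.analyticAt.differentiableAt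
    funext z
    by_cases hz : z = 0
    · have : ext (f + g : H2) = ext f + ext g := ext_add f g
      simp only [backwardShift, hz, if_true, Pi.add_apply, discDeriv, this,
        Complex.UnitDisc.coe_zero]
      exact deriv_add h0 h1
    · simp only [backwardShift, hz, if_false, Pi.add_apply, H2.add_apply]
      ring
  · intro c f
    have h0 : DifferentiableAt ℂ (ext f) 0 := f.holomorphic.analyticAt.differentiableAt
    funext z
    by_cases hz : z = 0
    · have : ext (c • f : H2) = c • ext f := ext_smul c f
      simp only [backwardShift, hz, if_true, Pi.smul_apply, discDeriv, this,
        Complex.UnitDisc.coe_zero]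
      exact deriv_const_smul c h0
    · simp only [backwardShift, hz, if_false, Pi.smul_apply, H2.smul_apply, smul_eq_mul]
      ring
  · intro f r hr2 hr0 hr
    have hi := f.holomorphic.circleIntegrable hr0 hr
    calc circleAverage (fun z => ‖ext (backwardShift f) z‖ ^ 2) 0 r
        ≤ circleAverage (fun z => (8 : ℝ) • (‖ext f z‖ ^ 2 + ‖f 0‖ ^ 2)) 0 r := by
          refine Real.circleAverage_mono (f.holomorphic.backwardShift.circleIntegrable hr0 hr)
            ((hi.add (circleIntegrable_const _ _ _)).const_fun_smul) fun z hz => ?_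
          have hzr : ‖z‖ = r := by rw [mem_sphere_zero_iff_norm.1 hz, abs_of_nonneg hr0]
          have hz1 : ‖z‖ < 1 := hzr ▸ hr
          rw [ext_of_norm_lt _ hz1, ext_of_norm_lt _ hz1, smul_eq_mul]
          have h := coe_mul_backwardShift f (Complex.UnitDisc.mk z hz1)
          have h2 := congrArg norm h
          rw [norm_mul, Complex.UnitDisc.coe_mk, hzr] at h2
          have h3 := norm_sub_le (f (Complex.UnitDisc.mk z hz1)) (f 0)
          rw [← h2] at h3
          have h4 : ‖backwardShift f (Complex.UnitDisc.mk z hz1)‖ ≤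
              2 * (‖f (Complex.UnitDisc.mk z hz1)‖ + ‖f 0‖) := by
            nlinarith [norm_nonneg (backwardShift f (Complex.UnitDisc.mk z hz1))]
          calc _ ≤ (2 * (‖f (Complex.UnitDisc.mk z hz1)‖ + ‖f 0‖)) ^ 2 :=
                pow_le_pow_left₀ (norm_nonneg _) h4 2
            _ ≤ _ := by nlinarith [sq_nonneg (‖f (Complex.UnitDisc.mk z hz1)‖ - ‖f 0‖)]
      _ = 8 * (circleAverage (fun z => ‖ext f z‖ ^ 2) 0 r + ‖f 0‖ ^ 2) := by
          rw [Real.circleAverage_fun_smul, smul_eq_mul,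
            Real.circleAverage_fun_add hi (circleIntegrable_const _ _ _), Real.circleAverage_const]
      _ ≤ 16 * ‖f‖ ^ 2 := by
          linarith [f.circleAverage_le hr0 hr, f.norm_apply_zero_le]

/-! ### Composition operators -/

/-- The holomorphic function `F²` is the Poisson integral of its values on the circle; take absolute
values under the nonnegative kernel. -/
theorem norm_sq_le_circleAverage_poissonKernel {F : 𝔻 → ℂ} (hF : HolomorphicOnDisc F) {R : ℝ}
    (hR0 : 0 < R) (hR : R < 1) {w : ℂ} (hw : ‖w‖ < R) :
    ‖ext F w‖ ^ 2 ≤ circleAverage (fun ζ => poissonKernel 0 w ζ * ‖ext F ζ‖ ^ 2) 0 R := by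
  have hd : DiffContOnCl ℂ (fun z => ext F z ^ 2) (Metric.ball 0 R) := by
    refine DifferentiableOn.diffContOnCl_ball (U := Metric.ball 0 1) (DifferentiableOn.pow hF 2) ?_
    exact Metric.closedBall_subset_ball hR
  have h := hd.circleAverage_poissonKernel_smul (mem_ball_zero_iff.2 hw)
  rw [← norm_pow, ← h, Real.circleAverage, Real.circleAverage, norm_smul, smul_eq_mul,
    Real.norm_of_nonneg (by positivity)]
  gcongr
  refine (intervalIntegral.norm_integral_le_integral_norm Real.two_pi_pos.le).trans (le_of_eq ?_)
  congr 1
  funext θ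
  rw [Pi.smul_apply', norm_smul, norm_pow, Real.norm_of_nonneg]
  rw [poissonKernel_def]
  have : ‖circleMap 0 R θ - 0‖ = R := by simp [abs_of_pos hR0]
  rw [this, sub_zero w]
  refine div_nonneg (sub_nonneg.2 ?_) (by positivity)
  exact pow_le_pow_left₀ (norm_nonneg _) hw.le 2

/-- In its pole the Poisson kernel is the real part of the Herglotz kernel `(ζ + w) / (ζ - w)`,
which is holomorphic in `w`. Composed with `ψ` it satisfies the mean value property; `hb` keeps the
denominator nonzero. -/
theorem circleAverage_poissonKernel_comp {ψ : 𝔻 → 𝔻}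
    (hψ : HolomorphicOnDisc (fun z => (ψ z : ℂ))) {r R : ℝ} (hr0 : 0 ≤ r) (hr : r < 1)
    (hb : ∀ z : ℂ, ‖z‖ ≤ r → ‖ext (fun z => (ψ z : ℂ)) z‖ < R) {ζ : ℂ} (hζ : ‖ζ‖ = R) :
    circleAverage (fun z => poissonKernel 0 (ext (fun z => (ψ z : ℂ)) z) ζ) 0 r =
      poissonKernel 0 (ψ 0) ζ := by
  set Ψ := ext (fun z => (ψ z : ℂ)) with hΨ
  have hne : ∀ z : ℂ, ‖z‖ ≤ r → ζ - Ψ z ≠ 0 := by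
    intro z hz h
    have := hb z hz
    rw [← sub_eq_zero.1 h, hζ] at this
    exact lt_irrefl _ this
  have hc : ContinuousOn (fun z => herglotzRieszKernel 0 (Ψ z) ζ) (Metric.closedBall 0 r) := by
    have hc' : ContinuousOn Ψ (Metric.closedBall 0 r) :=
      hψ.continuousOn.mono (Metric.closedBall_subset_ball hr)
    simp only [herglotzRieszKernel_def, sub_zero]
    exact ContinuousOn.div (by fun_prop) (by fun_prop) fun z hz =>
      hne z (mem_closedBall_zero_iff.1 hz)
  have hd : DiffContOnCl ℂ (fun z => herglotzRieszKernel 0 (Ψ z) ζ) (Metric.ball 0 |r|) := by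
    rw [abs_of_nonneg hr0]
    refine DiffContOnCl.mk_ball ?_ hc
    have hd' : DifferentiableOn ℂ Ψ (Metric.ball 0 r) :=
      DifferentiableOn.mono hψ (Metric.ball_subset_ball hr.le)
    simp only [herglotzRieszKernel_def, sub_zero]
    exact DifferentiableOn.div (by fun_prop) (by fun_prop) fun z hz =>
      hne z (mem_ball_zero_iff.1 hz).le
  have h := hd.circleAverage
  have hΨ0 : Ψ 0 = ψ 0 := ext_coe _ 0
  rw [hΨ0] at h
  have hi : CircleIntegrable (fun z => herglotzRieszKernel 0 (Ψ z) ζ) 0 r :=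
    (hc.mono Metric.sphere_subset_closedBall).circleIntegrable hr0
  have h2 := Complex.reCLM.circleAverage_comp_comm hi
  rw [h] at h2
  rw [poissonKernel_eq_re_herglotzRieszKernel]
  simp_rw [poissonKernel_eq_re_herglotzRieszKernel]
  exact h2

/-- Littlewood's subordination principle, in the form of a bound for integral means. -/
theorem circleAverage_comp_le {ψ : 𝔻 → 𝔻} (hψ : HolomorphicOnDisc (fun z => (ψ z : ℂ)))
    (f : H2) {r : ℝ} (hr0 : 0 ≤ r) (hr : r < 1) :
    circleAverage (fun z => ‖ext (compOp ψ f) z‖ ^ 2) 0 r ≤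
      4 / (1 - ‖(ψ 0 : ℂ)‖) * ‖f‖ ^ 2 := by
  set Ψ := ext (fun z => (ψ z : ℂ)) with hΨ
  have hΨlt : ∀ z : ℂ, ‖z‖ < 1 → ‖Ψ z‖ < 1 := fun z hz => by
    rw [hΨ, ext_of_norm_lt _ hz]
    exact Complex.UnitDisc.norm_lt_one _
  have hΨc : ContinuousOn Ψ (Metric.closedBall 0 r) :=
    hψ.continuousOn.mono (Metric.closedBall_subset_ball hr)
  have ha : ‖(ψ 0 : ℂ)‖ < 1 := Complex.UnitDisc.norm_lt_one _
  -- The circle of radius `R` must enclose the image of the closed disc of radius `r`. With `a =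
  -- |ψ(0)|`, the lower bound gives `R - a ≥ (1 - a) / 2`, so the kernel at `ψ(0)` is at most `(R +
  -- a) / (R - a) ≤ 4 / (1 - a)`.
  obtain ⟨R, hR1, haR, hb⟩ : ∃ R < 1, (1 + ‖(ψ 0 : ℂ)‖) / 2 ≤ R ∧
      ∀ z : ℂ, ‖z‖ ≤ r → ‖Ψ z‖ < R := by
    obtain ⟨z₀, hz₀, hmax⟩ := (isCompact_closedBall (0 : ℂ) r).exists_isMaxOn
      ⟨0, by simpa using hr0⟩ hΨc.norm
    have h1 := hΨlt z₀ ((mem_closedBall_zero_iff.1 hz₀).trans_lt hr)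
    obtain ⟨R, hR, hR1⟩ := exists_between
      (show max ((1 + ‖(ψ 0 : ℂ)‖) / 2) ‖Ψ z₀‖ < 1 from max_lt (by linarith) h1)
    refine ⟨R, hR1, (le_max_left _ _).trans hR.le, fun z hz => ?_⟩
    exact lt_of_le_of_lt (hmax (mem_closedBall_zero_iff.2 hz)) ((le_max_right _ _).trans_lt hR)
  have hR0 : 0 < R := lt_of_lt_of_le (by positivity) haR
  have hsph : ∀ z ∈ Metric.sphere (0 : ℂ) |r|, ‖z‖ = r := fun z hz => by
    rw [mem_sphere_zero_iff_norm.1 hz, abs_of_nonneg hr0]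
  have hΨθ : Continuous fun θ => Ψ (circleMap 0 r θ) := hψ.continuous_circleMap hr0 hr
  have hfθ : Continuous fun θ => ext f (circleMap 0 R θ) :=
    f.holomorphic.continuous_circleMap hR0.le hR1
  have hK : Continuous fun x : ℝ × ℝ =>
      poissonKernel 0 (Ψ (circleMap 0 r x.1)) (circleMap 0 R x.2) *
        ‖ext f (circleMap 0 R x.2)‖ ^ 2 := by
    have h1 : Continuous fun x : ℝ × ℝ => Ψ (circleMap 0 r x.1) := hΨθ.comp continuous_fst
    have h2 : Continuous fun x : ℝ × ℝ => ext f (circleMap 0 R x.2) := hfθ.comp continuous_snd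
    have h3 : Continuous fun x : ℝ × ℝ => circleMap 0 R x.2 :=
      (continuous_circleMap 0 R).comp continuous_snd
    simp only [poissonKernel_def, sub_zero]
    refine Continuous.mul (((h3.norm.pow 2).sub (h1.norm.pow 2)).div₀ ((h3.sub h1).norm.pow 2)
      fun x => ?_) (h2.norm.pow 2)
    refine pow_ne_zero 2 (norm_ne_zero_iff.2 fun h => ?_)
    have := hb (circleMap 0 r x.1) (by simp [abs_of_nonneg hr0])
    rw [← sub_eq_zero.1 h] at this
    simp [abs_of_pos hR0] at this
  have hswap : circleAverage (fun z => circleAverage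
        (fun ζ => poissonKernel 0 (Ψ z) ζ * ‖ext f ζ‖ ^ 2) 0 R) 0 r =
      circleAverage (fun ζ => circleAverage
        (fun z => poissonKernel 0 (Ψ z) ζ * ‖ext f ζ‖ ^ 2) 0 r) 0 R := by
    simp only [circleAverage, intervalIntegral.integral_smul]
    congr 2
    simp only [intervalIntegral.integral_of_le Real.two_pi_pos.le]
    refine MeasureTheory.integral_integral_swap
      (f := fun x y => poissonKernel 0 (Ψ (circleMap 0 r x)) (circleMap 0 R y) *
        ‖ext f (circleMap 0 R y)‖ ^ 2) ?_
    rw [MeasureTheory.Measure.prod_restrict]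
    exact ((hK.continuousOn (s := Set.Icc 0 (2 * Real.pi) ×ˢ Set.Icc 0 (2 * Real.pi))
      ).integrableOn_compact (isCompact_Icc.prod isCompact_Icc)).mono_set
      (Set.prod_mono Set.Ioc_subset_Icc_self Set.Ioc_subset_Icc_self)
  have hinner : Continuous fun θ => circleAverage
      (fun ζ => poissonKernel 0 (Ψ (circleMap 0 r θ)) ζ * ‖ext f ζ‖ ^ 2) 0 R := by
    simp only [circleAverage]
    have h := intervalIntegral.continuous_parametric_intervalIntegral_of_continuous'
      (μ := MeasureTheory.volume)
      (f := fun x y => poissonKernel 0 (Ψ (circleMap 0 r x)) (circleMap 0 R y) *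
        ‖ext f (circleMap 0 R y)‖ ^ 2) hK 0 (2 * Real.pi)
    exact h.const_smul (2 * Real.pi)⁻¹
  have hcomp : ∀ ζ ∈ Metric.sphere (0 : ℂ) |R|, circleAverage
      (fun z => poissonKernel 0 (Ψ z) ζ * ‖ext f ζ‖ ^ 2) 0 r =
        poissonKernel 0 (ψ 0) ζ * ‖ext f ζ‖ ^ 2 := by
    intro ζ hζ
    have hζR : ‖ζ‖ = R := by rw [mem_sphere_zero_iff_norm.1 hζ, abs_of_pos hR0]
    rw [← circleAverage_poissonKernel_comp hψ hr0 hr hb hζR, mul_comm, ← smul_eq_mul,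
      ← Real.circleAverage_fun_smul]
    simp only [smul_eq_mul, mul_comm, hΨ]
  have hmean := f.holomorphic.circleIntegrable hR0.le hR1
  -- Majorize `|f ∘ ψ|²` by a Poisson integral over `|ζ| = R`, exchange the two averages, and
  -- replace the average of the kernel over `z` by its value at `ψ(0)`.
  calc circleAverage (fun z => ‖ext (compOp ψ f) z‖ ^ 2) 0 r
      ≤ circleAverage (fun z => circleAverage
        (fun ζ => poissonKernel 0 (Ψ z) ζ * ‖ext f ζ‖ ^ 2) 0 R) 0 r := by
        refine Real.circleAverage_mono ((f.holomorphic.comp hψ).circleIntegrable hr0 hr)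
          (hinner.intervalIntegrable _ _) fun z hz => ?_
        have hz1 : ‖z‖ < 1 := hsph z hz ▸ hr
        have h := norm_sq_le_circleAverage_poissonKernel f.holomorphic hR0 hR1
          (hb z (hsph z hz).le)
        refine le_trans (le_of_eq ?_) h
        rw [hΨ, ext_of_norm_lt _ hz1, ext_of_norm_lt _ hz1, ext_coe, compOp]
    _ = circleAverage (fun ζ => poissonKernel 0 (ψ 0) ζ * ‖ext f ζ‖ ^ 2) 0 R := by
        rw [hswap]
        exact Real.circleAverage_congr_sphere hcomp
    _ ≤ circleAverage (fun ζ => (4 / (1 - ‖(ψ 0 : ℂ)‖)) • ‖ext f ζ‖ ^ 2) 0 R := by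
        have haR' : ‖(ψ 0 : ℂ)‖ < R := by linarith
        refine Real.circleAverage_mono ?_ hmean.const_fun_smul fun ζ hζ => ?_
        · refine ((ContinuousOn.mul ?_ ?_).circleIntegrable hR0.le)
          · have h := continuousOn_herglotzRieszKernel_sphere (mem_ball_zero_iff.2 haR')
            rw [abs_of_pos hR0] at h
            rw [poissonKernel_eq_re_herglotzRieszKernel]
            exact Complex.continuous_re.comp_continuousOn h
          · refine (f.holomorphic.continuousOn.mono fun z hz => ?_).norm.pow 2
            rw [mem_sphere_zero_iff_norm] at hz
            exact mem_ball_zero_iff.2 (hz ▸ hR1)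
        · rw [abs_of_pos hR0] at hζ
          have h := re_herglotzRieszKernel_le hζ (mem_ball_zero_iff.2 haR')
          rw [smul_eq_mul]
          gcongr
          rw [poissonKernel_eq_re_herglotzRieszKernel]
          refine h.trans ?_
          rw [sub_zero, div_le_div_iff₀ (by linarith) (by linarith)]
          nlinarith [norm_nonneg (ψ 0 : ℂ)]
    _ ≤ 4 / (1 - ‖(ψ 0 : ℂ)‖) * ‖f‖ ^ 2 := by
        rw [Real.circleAverage_fun_smul, smul_eq_mul]
        refine mul_le_mul_of_nonneg_left ?_ (div_nonneg (by norm_num) (by linarith))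
        exact f.circleAverage_le hR0.le hR1

theorem exists_realizes_compOp {ψ : 𝔻 → 𝔻} (hψ : HolomorphicOnDisc (fun z => (ψ z : ℂ))) :
    ∃ T : H2 →L[ℂ] H2, Realizes (compOp ψ) T :=
  exists_realizes (r₀ := 0) (fun _ _ => rfl) (fun _ _ => rfl) (fun f => f.holomorphic.comp hψ)
    (div_nonneg (by norm_num) (by linarith [(ψ 0).norm_lt_one])) one_pos
    fun f _ _ hr0 hr => circleAverage_comp_le hψ f hr0 hr

/-! ### Reproducing kernels -/

theorem exists_kernel (w : 𝔻) : ∃ k : H2, ∀ n, coeff k n = (starRingEnd ℂ) (w : ℂ) ^ n := by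
  have hmem : Memℓp (fun n : ℕ => (starRingEnd ℂ) (w : ℂ) ^ n) 2 := by
    rw [memℓp_gen_iff (by norm_num)]
    simp only [norm_pow, RCLike.norm_conj, ENNReal.toReal_ofNat, Real.rpow_two, ← pow_mul]
    simp only [mul_comm _ 2, pow_mul]
    exact summable_geometric_of_lt_one (by positivity) w.sq_norm_lt_one
  obtain ⟨k, hk⟩ := H2.toL2_surjective ⟨_, hmem⟩
  refine ⟨k, fun n => ?_⟩
  rw [← H2.toL2_apply, hk]

/-- The reproducing kernel of the Hardy space at `w`. -/
def kernel (w : 𝔻) : H2 := (exists_kernel w).choose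

theorem coeff_kernel (w : 𝔻) (n : ℕ) : coeff (kernel w) n = (starRingEnd ℂ) (w : ℂ) ^ n :=
  (exists_kernel w).choose_spec n

theorem norm_conj_mul_lt_one (w z : 𝔻) : ‖(starRingEnd ℂ) (w : ℂ) * (z : ℂ)‖ < 1 := by
  rw [norm_mul, RCLike.norm_conj]
  exact mul_lt_one_of_nonneg_of_lt_one_left (norm_nonneg _) w.norm_lt_one z.norm_lt_one.le

theorem one_sub_conj_mul_ne_zero (w z : 𝔻) : 1 - (starRingEnd ℂ) (w : ℂ) * (z : ℂ) ≠ 0 := by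
  intro h
  have h1 := norm_conj_mul_lt_one w z
  rw [← sub_eq_zero.1 h, norm_one] at h1
  exact lt_irrefl _ h1

theorem kernel_apply (w z : 𝔻) :
    kernel w z = 1 / (1 - (starRingEnd ℂ) (w : ℂ) * (z : ℂ)) := by
  have h := (kernel w).holomorphic.hasSum z
  simp only [coeff_kernel, ← mul_pow] at h
  rw [one_div]
  exact h.unique (hasSum_geometric_of_norm_lt_one (norm_conj_mul_lt_one w z))

theorem inner_kernel (w : 𝔻) (f : H2) : inner ℂ (kernel w) f = f w := by
  rw [H2.inner_eq, ← (f.holomorphic.hasSum w).tsum_eq]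
  simp only [coeff_kernel, map_pow, Complex.conj_conj]

/-- The operator is `f ↦ ⟨f, K_0⟩ K_a`, since `f(0) = ⟨f, K_0⟩`. -/
theorem exists_realizes_rankOne (a : 𝔻) : ∃ T : H2 →L[ℂ] H2, Realizes (rankOne a) T := by
  refine ⟨(innerSL ℂ (kernel 0)).smulRight (kernel a), fun f => ?_⟩
  funext z
  rw [ContinuousLinearMap.smulRight_apply, innerSL_apply_apply, inner_kernel, H2.smul_apply,
    kernel_apply, rankOne, mul_one_div]

/-- Kernels are eigenvectors of the backward shift, which turns the formula of (a), tested on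
kernels, into a scalar identity. -/
theorem backwardShift_kernel (w z : 𝔻) :
    backwardShift (kernel w) z = (starRingEnd ℂ) (w : ℂ) * kernel w z := by
  have hd : HasDerivAt (fun z : ℂ => 1 / (1 - (starRingEnd ℂ) (w : ℂ) * z))
      ((starRingEnd ℂ) (w : ℂ)) 0 := by
    have h := (((hasDerivAt_id (0 : ℂ)).const_mul ((starRingEnd ℂ) (w : ℂ))).const_sub 1).inv
      (by simp)
    simpa using! h
  by_cases hz : z = 0
  · have he : ext (kernel w) =ᶠ[𝓝 0] fun z : ℂ => 1 / (1 - (starRingEnd ℂ) (w : ℂ) * z) := by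
      filter_upwards [Metric.ball_mem_nhds (0 : ℂ) one_pos] with x hx
      rw [ext_of_norm_lt _ (mem_ball_zero_iff.1 hx), kernel_apply]
      rfl
    rw [backwardShift, if_pos hz, discDeriv, hz, Complex.UnitDisc.coe_zero, he.deriv_eq, hd.deriv,
      kernel_apply]
    simp
  · have hz' : (z : ℂ) ≠ 0 := by simpa using hz
    have h1 := one_sub_conj_mul_ne_zero w z
    rw [backwardShift, if_neg hz, kernel_apply, kernel_apply]
    simp only [Complex.UnitDisc.coe_zero, mul_zero, sub_zero, div_one]
    field_simp
    ring

/-- The adjoint of a composition operator is determined by its values on reproducing kernels. -/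
theorem adjoint_eq_of_kernel {ψ : 𝔻 → 𝔻} {C S : H2 →L[ℂ] H2} (hC : Realizes (compOp ψ) C)
    (hS : ∀ w z, S (kernel w) z = kernel (ψ w) z) : ContinuousLinearMap.adjoint C = S := by
  -- By the reproducing property, `(S^* f)(w) = ⟨f, S K_w⟩ = ⟨f, K_{ψ(w)}⟩ = f(ψ(w))`.
  have h : C = ContinuousLinearMap.adjoint S := by
    ext f
    refine H2.ext_fun fun w => ?_
    rw [← inner_kernel w (ContinuousLinearMap.adjoint S f),
      ContinuousLinearMap.adjoint_inner_right, H2.ext_fun (hS w), inner_kernel]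
    exact congrFun (hC f) w
  rw [h, ContinuousLinearMap.adjoint_adjoint]

end Operators

/-! ### Partial fractions, and branches as sections of a covering of the disc -/

section Branches

open Polynomial Filter Topology

/-! ### Partial fractions -/

/-- The nodal polynomial is monic of degree `d`, so the difference of the two sides has degree below
`d` and yet vanishes at `d` points. -/
theorem eq_C_mul_nodal {d : ℕ} {F : ℂ[X]} (hF : F.natDegree ≤ d) {v : Fin d → ℂ}
    (hv : Function.Injective v) (h0 : ∀ i, F.eval (v i) = 0) :
    F = C (F.coeff d) * Lagrange.nodal Finset.univ v := by
  have hn : (Lagrange.nodal Finset.univ v).natDegree = d := by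
    rw [Lagrange.natDegree_nodal, Finset.card_univ, Fintype.card_fin]
  refine eq_of_degree_sub_lt_of_eval_index_eq (s := Finset.univ) (v := v)
    (fun i _ j _ hij => hv hij) ?_ fun i hi => ?_
  · rw [Finset.card_univ, Fintype.card_fin, degree_lt_iff_coeff_zero]
    intro m hm
    have hnd : (Lagrange.nodal Finset.univ v).coeff d = 1 := by
      have := (Lagrange.nodal_monic (s := Finset.univ) (v := v)).coeff_natDegree
      rwa [hn] at this
    rw [coeff_sub, coeff_C_mul]
    rcases hm.eq_or_lt with rfl | hm
    · rw [hnd, mul_one, sub_self]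
    · rw [coeff_eq_zero_of_natDegree_lt (hF.trans_lt hm),
        coeff_eq_zero_of_natDegree_lt (hn.trans_lt hm), mul_zero, sub_zero]
  · rw [h0, eval_mul, Lagrange.eval_nodal_at_node hi, mul_zero]

theorem eval_derivative_nodal_ne_zero {d : ℕ} {v : Fin d → ℂ} (hv : Function.Injective v)
    (i : Fin d) : (derivative (Lagrange.nodal Finset.univ v)).eval (v i) ≠ 0 := by
  have h := Lagrange.nodalWeight_ne_zero (s := Finset.univ) hv.injOn (Finset.mem_univ i)
  rw [Lagrange.nodalWeight_eq_eval_derivative_nodal (Finset.mem_univ i)] at h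
  exact fun h0 => h (by rw [h0, inv_zero])

theorem eval_derivative_ne_zero {d : ℕ} {F : ℂ[X]} (hF : F.natDegree ≤ d) (hc : F.coeff d ≠ 0)
    {v : Fin d → ℂ} (hv : Function.Injective v) (h0 : ∀ i, F.eval (v i) = 0) (i : Fin d) :
    (derivative F).eval (v i) ≠ 0 := by
  rw [eq_C_mul_nodal hF hv h0, derivative_C_mul, eval_mul, eval_C]
  exact mul_ne_zero hc (eval_derivative_nodal_ne_zero hv i)

/-- The partial fraction expansion of `p / F`, where `F` has simple zeros and `deg p ≤ deg F`. -/
theorem sum_partialFraction {d : ℕ} {F p : ℂ[X]} (hF : F.natDegree ≤ d) (hc : F.coeff d ≠ 0)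
    (hp : p.natDegree ≤ d) {v : Fin d → ℂ} (hv : Function.Injective v)
    (h0 : ∀ i, F.eval (v i) = 0) {u : ℂ} (hu : F.eval u ≠ 0) :
    ∑ i, p.eval (v i) / (derivative F).eval (v i) / (u - v i) =
      p.eval u / F.eval u - p.coeff d / F.coeff d := by
  have hFn := eq_C_mul_nodal hF hv h0
  set c := F.coeff d with hcd
  set N := Lagrange.nodal Finset.univ v with hN
  -- Removing the coefficient at degree `d` makes `r` equal to its Lagrange interpolant at the zeros
  -- of `F`. The multiple of `F` taken away is the constant term of the expansion.
  let r : ℂ[X] := p - C (p.coeff d / c) * F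
  have hr : r.degree < (Finset.univ : Finset (Fin d)).card := by
    rw [Finset.card_univ, Fintype.card_fin, degree_lt_iff_coeff_zero]
    intro m hm
    rw [coeff_sub, coeff_C_mul]
    rcases hm.eq_or_lt with rfl | hm
    · rw [← hcd, div_mul_cancel₀ _ hc, sub_self]
    · rw [coeff_eq_zero_of_natDegree_lt (hF.trans_lt hm),
        coeff_eq_zero_of_natDegree_lt (hp.trans_lt hm), mul_zero, sub_zero]
  have hri : ∀ i, r.eval (v i) = p.eval (v i) := fun i => by simp [r, h0]
  have hne : ∀ i ∈ (Finset.univ : Finset (Fin d)), u ≠ v i := fun i _ h => hu (h ▸ h0 i)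
  have h1 := congrArg (eval u) (Lagrange.eq_interpolate hv.injOn hr)
  rw [Lagrange.eval_interpolate_not_at_node _ hne] at h1
  have hFu : F.eval u = c * N.eval u := by
    conv_lhs => rw [hFn]
    rw [eval_mul, eval_C]
  have hNu : N.eval u ≠ 0 := fun h => hu (by rw [hFu, h, mul_zero])
  have hru : r.eval u = p.eval u - p.coeff d / c * F.eval u := by simp [r]
  have hsum : ∑ i, p.eval (v i) / (derivative F).eval (v i) / (u - v i) =
      c⁻¹ * ∑ i, Lagrange.nodalWeight Finset.univ v i * (u - v i)⁻¹ * r.eval (v i) := by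
    rw [Finset.mul_sum]
    refine Finset.sum_congr rfl fun i hi => ?_
    have hd : (derivative F).eval (v i) = c * (derivative N).eval (v i) := by
      conv_lhs => rw [hFn]
      rw [derivative_C_mul, eval_mul, eval_C]
    rw [hri, Lagrange.nodalWeight_eq_eval_derivative_nodal hi, hd, div_eq_mul_inv, div_eq_mul_inv,
      mul_inv]
    ring
  rw [hsum]
  have h2 : ∑ i, Lagrange.nodalWeight Finset.univ v i * (u - v i)⁻¹ * r.eval (v i) =
      r.eval u / N.eval u := by
    rw [h1, mul_div_cancel_left₀ _ hNu]
  rw [h2, hru, hFu]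
  field_simp

/-! ### Branches of the inverse of a quotient of polynomials -/

/-- The polynomials `p` and `q` have no common zero, the quotient `q / p` has degree `d`, maps the
complement of the open unit disc into itself, and has only regular values in the closed unit
disc. -/
structure RegularPair (p q : ℂ[X]) (d : ℕ) : Prop where
  natDegree_left : p.natDegree ≤ d
  natDegree_right : q.natDegree ≤ d
  norm_coeff_lt : ‖p.coeff d‖ < ‖q.coeff d‖
  eval_ne_zero : ∀ u, p.eval u = 0 → q.eval u ≠ 0
  sub_ne_zero : ∀ u, 1 ≤ ‖u‖ → ∀ z, ‖z‖ < 1 → q.eval u - z * p.eval u ≠ 0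
  encard_fiber : ∀ z, ‖z‖ ≤ 1 → {u | q.eval u - z * p.eval u = 0}.encard = d

/-- The polynomial whose zeros are the solutions of `q / p = z`. -/
def fiberPoly (p q : ℂ[X]) (z : ℂ) : ℂ[X] := q - C z * p

theorem eval_fiberPoly (p q : ℂ[X]) (z u : ℂ) :
    (fiberPoly p q z).eval u = q.eval u - z * p.eval u := by simp [fiberPoly]

theorem eval_derivative_fiberPoly (p q : ℂ[X]) (z u : ℂ) :
    (derivative (fiberPoly p q z)).eval u =
      (derivative q).eval u - z * (derivative p).eval u := by simp [fiberPoly]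

namespace RegularPair

variable {p q : ℂ[X]} {d : ℕ}

theorem natDegree_fiberPoly (h : RegularPair p q d) (z : ℂ) :
    (fiberPoly p q z).natDegree ≤ d := by
  refine (natDegree_sub_le _ _).trans (max_le h.natDegree_right ?_)
  exact (natDegree_C_mul_le _ _).trans h.natDegree_left

theorem coeff_fiberPoly (z : ℂ) :
    (fiberPoly p q z).coeff d = q.coeff d - z * p.coeff d := by simp [fiberPoly]

/-- The value of `q / p` at infinity lies outside the closed disc, so for `|z| ≤ 1` the formal
degree `d` of the fibre polynomial is its true degree. -/
theorem coeff_fiberPoly_ne_zero (h : RegularPair p q d) {z : ℂ} (hz : ‖z‖ ≤ 1) :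
    (fiberPoly p q z).coeff d ≠ 0 := by
  rw [coeff_fiberPoly]
  intro h0
  have h1 := congrArg norm (sub_eq_zero.1 h0)
  rw [norm_mul] at h1
  have := h.norm_coeff_lt
  nlinarith [norm_nonneg (p.coeff d)]

theorem exists_enum (h : RegularPair p q d) {z : ℂ} (hz : ‖z‖ ≤ 1) :
    ∃ v : Fin d → ℂ, Function.Injective v ∧
      Set.range v = {u | q.eval u - z * p.eval u = 0} := by
  have hc := h.encard_fiber z hz
  have hfin : {u | q.eval u - z * p.eval u = 0}.Finite :=
    Set.finite_of_encard_eq_coe hc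
  have := hfin.to_subtype
  have hcard : Nat.card {u | q.eval u - z * p.eval u = 0} = d := by
    rw [Nat.card_coe_set_eq, Set.ncard, hc, ENat.toNat_natCast]
  let e := Finite.equivFinOfCardEq hcard
  refine ⟨fun i => (e.symm i : ℂ), Subtype.val_injective.comp e.symm.injective, ?_⟩
  rw [← Function.comp_def, Set.range_comp, e.symm.surjective.range_eq, Set.image_univ,
    Subtype.range_coe]

theorem derivative_ne_zero (h : RegularPair p q d) {z u : ℂ} (hz : ‖z‖ ≤ 1)
    (hu : q.eval u - z * p.eval u = 0) : (derivative (fiberPoly p q z)).eval u ≠ 0 := by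
  obtain ⟨v, hv, hr⟩ := h.exists_enum hz
  obtain ⟨i, rfl⟩ : u ∈ Set.range v := by rw [hr]; exact hu
  refine eval_derivative_ne_zero (h.natDegree_fiberPoly z) (h.coeff_fiberPoly_ne_zero hz) hv
    (fun j => ?_) i
  have : v j ∈ Set.range v := Set.mem_range_self j
  rw [hr] at this
  rw [eval_fiberPoly]
  exact this

/-- A continuous function of `(z, u)` without zeros on the graph of the fibres over the disc is
bounded below there. -/
theorem exists_le_norm (h : RegularPair p q d) {g : ℂ × ℂ → ℂ} (hg : Continuous g)
    (h0 : ∀ z u, ‖z‖ ≤ 1 → q.eval u - z * p.eval u = 0 → g (z, u) ≠ 0) :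
    ∃ ε > 0, ∀ z u, ‖z‖ < 1 → q.eval u - z * p.eval u = 0 → ε ≤ ‖g (z, u)‖ := by
  -- Fibres over the open disc lie in the unit disc, so this compact set contains their graph. It
  -- may also contain points over `|z| = 1`, which is why `h0` is required there.
  let K : Set (ℂ × ℂ) := Metric.closedBall 0 1 ×ˢ Metric.closedBall 0 1 ∩
    {x | q.eval x.2 - x.1 * p.eval x.2 = 0}
  have hK : IsCompact K := by
    refine ((isCompact_closedBall 0 1).prod (isCompact_closedBall 0 1)).inter_right ?_
    exact isClosed_eq (by fun_prop) continuous_const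
  have hmem : ∀ z u, ‖z‖ < 1 → q.eval u - z * p.eval u = 0 → (z, u) ∈ K := by
    intro z u hz hu
    refine ⟨⟨mem_closedBall_zero_iff.2 hz.le, mem_closedBall_zero_iff.2 ?_⟩, hu⟩
    by_contra! hlt
    exact h.sub_ne_zero u hlt.le z hz hu
  rcases K.eq_empty_or_nonempty with hE | hE
  · exact ⟨1, one_pos, fun z u hz hu => absurd (hmem z u hz hu) (by simp [hE])⟩
  · obtain ⟨x, hx, hmin⟩ := hK.exists_isMinOn hE hg.norm.continuousOn
    refine ⟨‖g x‖, norm_pos_iff.2 (h0 x.1 x.2 (mem_closedBall_zero_iff.1 hx.1.1) hx.2), ?_⟩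
    exact fun z u hz hu => hmin (hmem z u hz hu)

/-- The preimage of the open unit disc under `q / p`. -/
def preimageDisc (p q : ℂ[X]) : Set ℂ := {u | ‖q.eval u‖ < ‖p.eval u‖}

theorem isOpen_preimageDisc : IsOpen (preimageDisc p q) :=
  isOpen_lt (by fun_prop) (by fun_prop)

theorem eval_ne_zero_of_mem {u : ℂ} (hu : u ∈ preimageDisc p q) : p.eval u ≠ 0 := by
  intro h0
  have hu' : ‖q.eval u‖ < ‖p.eval u‖ := hu
  rw [h0, norm_zero] at hu'
  exact absurd hu' (norm_nonneg _).not_gt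

theorem sub_eq_zero_iff (h : RegularPair p q d) {z u : ℂ} (hz : ‖z‖ < 1) :
    q.eval u - z * p.eval u = 0 ↔ u ∈ preimageDisc p q ∧ q.eval u / p.eval u = z := by
  constructor
  · intro h0
    have hp : p.eval u ≠ 0 := fun hp => h.eval_ne_zero u hp (by simpa [hp] using h0)
    have hq : q.eval u = z * p.eval u := sub_eq_zero.1 h0
    refine ⟨?_, by rw [hq, mul_div_cancel_right₀ _ hp]⟩
    change ‖q.eval u‖ < ‖p.eval u‖
    rw [hq, norm_mul]
    exact mul_lt_of_lt_one_left (norm_pos_iff.2 hp) hz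
  · rintro ⟨hu, rfl⟩
    rw [div_mul_cancel₀ _ (eval_ne_zero_of_mem hu), sub_self]

/-- The restriction of `q / p` to the preimage of the open unit disc. -/
def quotMap (p q : ℂ[X]) (u : preimageDisc p q) : Metric.ball (0 : ℂ) 1 :=
  ⟨q.eval u.1 / p.eval u.1, by
    rw [mem_ball_zero_iff, norm_div]
    exact (div_lt_one (norm_pos_iff.2 (eval_ne_zero_of_mem u.2))).2 u.2⟩

theorem continuous_quotMap : Continuous (quotMap p q) := by
  refine Continuous.subtype_mk (Continuous.div ?_ ?_ fun u => eval_ne_zero_of_mem u.2) _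
  · exact q.continuous.comp continuous_subtype_val
  · exact p.continuous.comp continuous_subtype_val

/-- The preimage of a compact `K` is the projection to `u` of the compact set of pairs with `z ∈ K`,
`|u| ≤ 1` and `q(u) = z p(u)`; no preimage has `|u| ≥ 1`. -/
theorem isProperMap_quotMap (h : RegularPair p q d) : IsProperMap (quotMap p q) := by
  rw [isProperMap_iff_isCompact_preimage]
  refine ⟨continuous_quotMap, fun K hK => ?_⟩
  rw [Subtype.isCompact_iff]
  have hK' : IsCompact ((Subtype.val '' K) ×ˢ Metric.closedBall (0 : ℂ) 1 ∩
      {x : ℂ × ℂ | q.eval x.2 - x.1 * p.eval x.2 = 0}) :=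
    ((hK.image continuous_subtype_val).prod (isCompact_closedBall 0 1)).inter_right
      (isClosed_eq (by fun_prop) continuous_const)
  convert hK'.image continuous_snd using 1
  ext u
  constructor
  · rintro ⟨u, hu, rfl⟩
    have hz := mem_ball_zero_iff.1 (quotMap p q u).2
    have h0 := (h.sub_eq_zero_iff hz).2 ⟨u.2, rfl⟩
    refine ⟨((quotMap p q u : ℂ), (u : ℂ)), ⟨⟨⟨_, hu, rfl⟩, mem_closedBall_zero_iff.2 ?_⟩, h0⟩, rfl⟩
    by_contra! hlt
    exact h.sub_ne_zero u hlt.le _ hz h0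
  · rintro ⟨⟨_, u⟩, ⟨⟨⟨z, hz, rfl⟩, -⟩, h0⟩, rfl⟩
    obtain ⟨hu, he⟩ := (h.sub_eq_zero_iff (mem_ball_zero_iff.1 z.2)).1 h0
    refine ⟨⟨u, hu⟩, ?_, rfl⟩
    have : quotMap p q ⟨u, hu⟩ = z := Subtype.ext he
    rw [Set.mem_preimage, this]
    exact hz

/-- With `z = q(u) / p(u)` the quotient rule becomes `(q' - z p') / p`. In this form the derivative
is nonzero because the zeros of the fibre polynomial are simple, and its reciprocal is the
derivative of a branch. -/
theorem hasStrictDerivAt_div {u : ℂ} (hu : p.eval u ≠ 0) :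
    HasStrictDerivAt (fun u => q.eval u / p.eval u)
      ((derivative (fiberPoly p q (q.eval u / p.eval u))).eval u / p.eval u) u := by
  have h := (q.hasStrictDerivAt u).fun_div (p.hasStrictDerivAt u) hu
  have he : (derivative (fiberPoly p q (q.eval u / p.eval u))).eval u / p.eval u =
      ((derivative q).eval u * p.eval u - q.eval u * (derivative p).eval u) / p.eval u ^ 2 := by
    rw [eval_derivative_fiberPoly]
    field_simp
  rw [he]
  exact h

theorem deriv_div_ne_zero (h : RegularPair p q d) {u : ℂ} (hu : u ∈ preimageDisc p q) :
    (derivative (fiberPoly p q (q.eval u / p.eval u))).eval u / p.eval u ≠ 0 := by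
  have hz := mem_ball_zero_iff.1 (quotMap p q ⟨u, hu⟩).2
  exact div_ne_zero (h.derivative_ne_zero (z := q.eval u / p.eval u) hz.le
    ((h.sub_eq_zero_iff hz).2 ⟨hu, rfl⟩)) (eval_ne_zero_of_mem hu)

theorem isLocalHomeomorph_quotMap (h : RegularPair p q d) : IsLocalHomeomorph (quotMap p q) := by
  have h1 : IsLocalHomeomorphOn (fun u => q.eval u / p.eval u) (preimageDisc p q) := fun u hu =>
    ⟨_, ((hasStrictDerivAt_div (eval_ne_zero_of_mem hu)).hasStrictFDerivAt_equiv
      (h.deriv_div_ne_zero hu)).mem_toOpenPartialHomeomorph_source, by simp⟩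
  have h2 : IsLocalHomeomorph (Subtype.val : preimageDisc p q → ℂ) :=
    (isOpen_preimageDisc.isOpenEmbedding_subtypeVal).isLocalHomeomorph
  have h3 : IsLocalHomeomorph (Subtype.val : Metric.ball (0 : ℂ) 1 → ℂ) :=
    (Metric.isOpen_ball.isOpenEmbedding_subtypeVal).isLocalHomeomorph
  refine IsLocalHomeomorph.of_comp (g := Subtype.val) ?_ h3 continuous_quotMap
  rw [isLocalHomeomorph_iff_isLocalHomeomorphOn_univ] at h2 ⊢
  exact h1.comp h2 fun u _ => u.2

/-- A closed local homeomorphism with finite fibres is a covering. -/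
theorem isCoveringMap_quotMap (h : RegularPair p q d) : IsCoveringMap (quotMap p q) := by
  rw [isCoveringMap_iff_isCoveringMapOn_univ]
  refine h.isProperMap_quotMap.isClosedMap.isCoveringMapOn_of_isLocalHomeomorphOn
    (fun z _ => ?_) (h.isLocalHomeomorph_quotMap.isLocalHomeomorphOn)
  have hz := mem_ball_zero_iff.1 z.2
  have hfin : {u | q.eval u - z * p.eval u = 0}.Finite :=
    Set.finite_of_encard_eq_coe (h.encard_fiber z hz.le)
  refine (hfin.preimage Subtype.val_injective.injOn).subset fun u hu => ?_
  exact (h.sub_eq_zero_iff hz).2 ⟨u.2, congrArg Subtype.val hu⟩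

/-- The inverse of `q / p` has `d` continuous branches on the disc, no two of which meet. -/
theorem exists_continuous_branches (h : RegularPair p q d) :
    ∃ s : Fin d → C(Metric.ball (0 : ℂ) 1, preimageDisc p q),
      (∀ j z, quotMap p q (s j z) = z) ∧ ∀ z, Function.Injective fun j => s j z := by
  have hconv : Convex ℝ (Metric.ball (0 : ℂ) 1) := convex_ball 0 1
  have : ContractibleSpace (Metric.ball (0 : ℂ) 1) := hconv.contractibleSpace ⟨0, by simp⟩
  have : LocallyPathConnectedSpace (Metric.ball (0 : ℂ) 1) :=
    Metric.isOpen_ball.locallyPathConnectedSpace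
  have hcov := h.isCoveringMap_quotMap
  let o : Metric.ball (0 : ℂ) 1 := ⟨0, by simp⟩
  -- The branches are the lifts of the identity of the disc that start at the `d` points over `0`.
  obtain ⟨v, hv, hr⟩ := h.exists_enum (z := 0) (by simp)
  have hmem : ∀ j, v j ∈ preimageDisc p q ∧ q.eval (v j) / p.eval (v j) = 0 := fun j => by
    have : v j ∈ Set.range v := Set.mem_range_self j
    rw [hr] at this
    exact (h.sub_eq_zero_iff (by simp)).1 this
  have hlift : ∀ j, ∃ s : C(Metric.ball (0 : ℂ) 1, preimageDisc p q),
      s o = ⟨v j, (hmem j).1⟩ ∧ quotMap p q ∘ s = ContinuousMap.id _ := fun j =>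
    (hcov.existsUnique_continuousMap_lifts (ContinuousMap.id _) o ⟨v j, (hmem j).1⟩
      (Subtype.ext (hmem j).2)).exists
  choose s hs0 hs using hlift
  refine ⟨s, fun j z => congrFun (hs j) z, fun z i j hij => hv ?_⟩
  -- Two lifts that meet at one point coincide, in particular over `0`, where their values determine
  -- the index.
  have := hcov.eq_of_comp_eq (s i).continuous (s j).continuous ((hs i).trans (hs j).symm) z hij
  have h0 := congrFun this o
  rw [hs0, hs0] at h0
  exact congrArg Subtype.val h0

theorem norm_lt_one_of_mem (h : RegularPair p q d) {u : ℂ} (hu : u ∈ preimageDisc p q) :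
    ‖u‖ < 1 := by
  by_contra! hlt
  have hz := mem_ball_zero_iff.1 (quotMap p q ⟨u, hu⟩).2
  exact h.sub_ne_zero u hlt _ hz ((h.sub_eq_zero_iff hz).2 ⟨hu, rfl⟩)

/-- The inverse of `q / p` has `d` holomorphic branches on the disc. -/
theorem exists_branches (h : RegularPair p q d) :
    ∃ σ : Fin d → 𝔻 → 𝔻, (∀ z, Function.Injective fun j => σ j z) ∧
      (∀ (z : 𝔻) (u : ℂ), q.eval u - z * p.eval u = 0 ↔ ∃ j, u = σ j z) ∧
      ∀ j (z : 𝔻), HasDerivAt (ext fun w => (σ j w : ℂ))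
        (p.eval (σ j z : ℂ) / (derivative (fiberPoly p q z)).eval (σ j z : ℂ)) z := by
  obtain ⟨s, hs, hinj⟩ := h.exists_continuous_branches
  let b : 𝔻 → Metric.ball (0 : ℂ) 1 := fun z => ⟨z, mem_ball_zero_iff.2 z.norm_lt_one⟩
  let σ : Fin d → 𝔻 → 𝔻 := fun j z =>
    Complex.UnitDisc.mk (s j (b z)) (h.norm_lt_one_of_mem (s j (b z)).2)
  have hσ : ∀ j z, (σ j z : ℂ) = s j (b z) := fun j z => rfl
  have hdiv : ∀ j (z : 𝔻), q.eval (σ j z : ℂ) / p.eval (σ j z : ℂ) = z := fun j z =>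
    congrArg Subtype.val (hs j (b z))
  have hσinj : ∀ z, Function.Injective fun j => (σ j z : ℂ) := fun z _ _ hij =>
    hinj (b z) (Subtype.ext hij)
  have hroot : ∀ j (z : 𝔻), q.eval (σ j z : ℂ) - z * p.eval (σ j z : ℂ) = 0 := fun j z =>
    (h.sub_eq_zero_iff z.norm_lt_one).2 ⟨(s j (b z)).2, hdiv j z⟩
  refine ⟨σ, fun z => (hσinj z).of_comp (f := Complex.UnitDisc.coe), fun z u => ⟨fun hu => ?_, ?_⟩,
    fun j z => ?_⟩
  · have hsub : Set.range (fun j => (σ j z : ℂ)) ⊆ {u | q.eval u - z * p.eval u = 0} := by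
      rintro _ ⟨j, rfl⟩
      exact hroot j z
    have heq := (Set.finite_range fun j => (σ j z : ℂ)).eq_of_subset_of_encard_le hsub (by
      rw [h.encard_fiber z z.norm_lt_one.le]
      refine le_trans ?_ (hσinj z).encard_range
      simp)
    have hu' : u ∈ Set.range fun j => (σ j z : ℂ) := by rw [heq]; exact hu
    obtain ⟨j, hj⟩ := hu'
    exact ⟨j, hj.symm⟩
  · rintro ⟨j, rfl⟩
    exact hroot j z
  · have hmem : (σ j z : ℂ) ∈ preimageDisc p q := (s j (b z)).2
    -- A continuous local right inverse of a function with nonzero derivative is differentiable,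
    -- with the reciprocal derivative.
    have hd := (hasStrictDerivAt_div (q := q) (eval_ne_zero_of_mem hmem)).hasDerivAt
    have hne := h.deriv_div_ne_zero hmem
    rw [hdiv] at hd hne
    have hext : ext (fun w => (σ j w : ℂ)) z = σ j z := ext_coe _ z
    have hcont : ContinuousAt (ext fun w => (σ j w : ℂ)) z := by
      have hball : Metric.ball (0 : ℂ) 1 ∈ 𝓝 (z : ℂ) :=
        Metric.isOpen_ball.mem_nhds (mem_ball_zero_iff.2 z.norm_lt_one)
      refine ContinuousOn.continuousAt (s := Metric.ball 0 1) ?_ hball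
      rw [continuousOn_iff_continuous_domRestrict]
      have : (Metric.ball (0 : ℂ) 1).domRestrict (ext fun w => (σ j w : ℂ)) =
          fun w => (s j w : ℂ) := by
        funext w
        exact ext_of_norm_lt (fun w => (σ j w : ℂ)) (mem_ball_zero_iff.1 w.2)
      rw [this]
      exact continuous_subtype_val.comp (s j).continuous
    rw [← hext] at hd
    have hev : ∀ᶠ w in 𝓝 (z : ℂ), q.eval (ext (fun w => (σ j w : ℂ)) w) /
        p.eval (ext (fun w => (σ j w : ℂ)) w) = w := by
      filter_upwards [Metric.isOpen_ball.mem_nhds (mem_ball_zero_iff.2 z.norm_lt_one)] with w hw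
      rw [ext_of_norm_lt _ (mem_ball_zero_iff.1 hw), hdiv]
      rfl
    have := hd.of_local_left_inverse hcont (by rw [hext]; exact hne) hev
    rwa [inv_div, hext] at this

end RegularPair

end Branches

/-! ### The exterior map as a quotient of polynomials, and its inverse branches -/

section Rational

open Polynomial Filter Topology

/-! ### Rational functions as pairs of polynomials -/

open Classical in
/-- The point of the sphere with homogeneous coordinates `(a : b)`. -/
def sphereFrac (a b : ℂ) : OnePoint ℂ :=
  if b = 0 then OnePoint.infty else ((a / b : ℂ) : OnePoint ℂ)

theorem sphereFrac_zero_right (a : ℂ) : sphereFrac a 0 = OnePoint.infty := if_pos rfl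

theorem sphereFrac_of_ne (a : ℂ) {b : ℂ} (hb : b ≠ 0) :
    sphereFrac a b = ((a / b : ℂ) : OnePoint ℂ) := if_neg hb

theorem sphereFrac_mul_left (a b : ℂ) {c : ℂ} (hc : c ≠ 0) :
    sphereFrac (c * a) (c * b) = sphereFrac a b := by
  by_cases hb : b = 0
  · rw [hb, mul_zero, sphereFrac_zero_right, sphereFrac_zero_right]
  · rw [sphereFrac_of_ne _ hb, sphereFrac_of_ne _ (mul_ne_zero hc hb), mul_div_mul_left _ _ hc]

theorem sphereFrac_eq_coe_iff {a b : ℂ} (h : b = 0 → a ≠ 0) (z : ℂ) :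
    sphereFrac a b = (z : OnePoint ℂ) ↔ a - z * b = 0 := by
  by_cases hb : b = 0
  · have := h hb
    simp [sphereFrac, hb, this]
  · rw [sphereFrac_of_ne _ hb, OnePoint.coe_eq_coe, div_eq_iff hb, sub_eq_zero]

theorem inversion_infty : inversion OnePoint.infty = ((0 : ℂ) : OnePoint ℂ) := rfl

theorem inversion_zero : inversion ((0 : ℂ) : OnePoint ℂ) = OnePoint.infty := if_pos rfl

theorem inversion_coe {z : ℂ} (hz : z ≠ 0) :
    inversion (z : OnePoint ℂ) = ((1 / (starRingEnd ℂ) z : ℂ) : OnePoint ℂ) := if_neg hz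

theorem inversion_inversion (x : OnePoint ℂ) : inversion (inversion x) = x := by
  induction x using OnePoint.rec with
  | infty => rw [inversion_infty, inversion_zero]
  | coe z =>
    by_cases hz : z = 0
    · rw [hz, inversion_zero, inversion_infty]
    · rw [inversion_coe hz, inversion_coe (by simpa using hz)]
      simp

theorem inversion_sphereFrac {a b : ℂ} (h : b = 0 → a ≠ 0) :
    inversion (sphereFrac a b) = sphereFrac ((starRingEnd ℂ) b) ((starRingEnd ℂ) a) := by
  by_cases hb : b = 0
  · have ha : (starRingEnd ℂ) a ≠ 0 := by simpa using h hb
    rw [hb, sphereFrac_zero_right, inversion_infty, map_zero, sphereFrac_of_ne _ ha, zero_div]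
  · rw [sphereFrac_of_ne _ hb]
    by_cases ha : a = 0
    · rw [ha, zero_div, inversion_zero, map_zero, sphereFrac_zero_right]
    · rw [inversion_coe (div_ne_zero ha hb), sphereFrac_of_ne _ (by simpa using ha), map_div₀,
        one_div_div]

theorem inversion_ne_toSphere {z : ℂ} (hz : ‖z‖ ≤ 1) (a : 𝔻) :
    inversion (z : OnePoint ℂ) ≠ toSphere a := by
  by_cases h0 : z = 0
  · rw [h0, inversion_zero]
    exact OnePoint.infty_ne_coe _
  · rw [inversion_coe h0]
    intro h
    have h1 := congrArg norm (OnePoint.coe_injective h)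
    rw [norm_div, norm_one, RCLike.norm_conj] at h1
    have h2 := (one_le_div (norm_pos_iff.2 h0)).2 hz
    exact absurd a.norm_lt_one (not_lt.2 (h1 ▸ h2))

theorem sphereMap_coe (R : RatFunc ℂ) (z : ℂ) :
    sphereMap R (z : OnePoint ℂ) = sphereFrac (R.num.eval z) (R.denom.eval z) := rfl

theorem natDegree_num_le (R : RatFunc ℂ) : R.num.natDegree ≤ ratDegree R := le_max_left _ _

theorem natDegree_denom_le (R : RatFunc ℂ) : R.denom.natDegree ≤ ratDegree R := le_max_right _ _

/-- The counterpart of coprimality at infinity: the coefficients at the formal degree are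
homogeneous coordinates of `R(∞)` and do not both vanish. -/
theorem coeff_num_ne_zero (R : RatFunc ℂ) (h : R.denom.coeff (ratDegree R) = 0) :
    R.num.coeff (ratDegree R) ≠ 0 := by
  rcases le_total R.num.natDegree R.denom.natDegree with hle | hle
  · rw [ratDegree, max_eq_right hle, coeff_natDegree, leadingCoeff_eq_zero] at h
    exact absurd h R.denom_ne_zero
  · rw [ratDegree, max_eq_left hle, coeff_natDegree, leadingCoeff_ne_zero]
    intro h0
    rw [ratDegree, max_eq_left hle, h0, natDegree_zero] at h
    rw [h0, natDegree_zero] at hle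
    rw [← Nat.le_zero.1 hle, coeff_natDegree, leadingCoeff_eq_zero] at h
    exact R.denom_ne_zero h

theorem sphereMap_infty (R : RatFunc ℂ) :
    sphereMap R OnePoint.infty =
      sphereFrac (R.num.coeff (ratDegree R)) (R.denom.coeff (ratDegree R)) := by
  change (if R.denom.natDegree < R.num.natDegree then OnePoint.infty
    else ((R.num.coeff R.denom.natDegree / R.denom.leadingCoeff : ℂ) : OnePoint ℂ)) = _
  split_ifs with h
  · rw [ratDegree, max_eq_left h.le, coeff_eq_zero_of_natDegree_lt h, sphereFrac_zero_right]
  · rw [ratDegree, max_eq_right (not_lt.1 h), coeff_natDegree,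
      sphereFrac_of_ne _ (leadingCoeff_ne_zero.2 R.denom_ne_zero)]

theorem eval_num_ne_zero (R : RatFunc ℂ) {z : ℂ} (h : R.denom.eval z = 0) :
    R.num.eval z ≠ 0 := by
  intro h0
  obtain ⟨a, b, hab⟩ := R.isCoprime_num_denom
  have := congrArg (eval z) hab
  simp [h, h0] at this

/-- The reflection of `f` in the unit circle, as a polynomial of formal degree `d`. -/
def conjReflect (d : ℕ) (f : ℂ[X]) : ℂ[X] := (f.map (starRingEnd ℂ)).reflect d

theorem natDegree_conjReflect {d : ℕ} {f : ℂ[X]} (hf : f.natDegree ≤ d) :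
    (conjReflect d f).natDegree ≤ d :=
  natDegree_reflect_le.trans (max_le le_rfl (natDegree_map_le.trans hf))

theorem coeff_conjReflect (d : ℕ) (f : ℂ[X]) :
    (conjReflect d f).coeff d = (starRingEnd ℂ) (f.eval 0) := by
  rw [conjReflect, coeff_reflect, revAt_le le_rfl, Nat.sub_self, coeff_map, coeff_zero_eq_eval_zero]

theorem eval_zero_conjReflect (d : ℕ) (f : ℂ[X]) :
    (conjReflect d f).eval 0 = (starRingEnd ℂ) (f.coeff d) := by
  rw [← coeff_zero_eq_eval_zero, conjReflect, coeff_reflect, revAt_zero, coeff_map]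

theorem eval_conjReflect {d : ℕ} {f : ℂ[X]} (hf : f.natDegree ≤ d) {u : ℂ} (hu : u ≠ 0) :
    (conjReflect d f).eval u = u ^ d * (starRingEnd ℂ) (f.eval (1 / (starRingEnd ℂ) u)) := by
  let i : Invertible u⁻¹ := invertibleOfNonzero (inv_ne_zero hu)
  have h := eval₂_reflect_mul_pow (RingHom.id ℂ) u⁻¹ d (f.map (starRingEnd ℂ))
    (natDegree_map_le.trans hf)
  rw [invOf_eq_inv, inv_inv] at h
  have h2 : eval₂ (RingHom.id ℂ) u⁻¹ (f.map (starRingEnd ℂ)) =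
      (starRingEnd ℂ) (f.eval (1 / (starRingEnd ℂ) u)) := by
    rw [← eval₂_at_apply, map_div₀, map_one, Complex.conj_conj, one_div]
    exact eval_map _ _
  rw [h2] at h
  rw [← h, mul_comm, mul_assoc, ← mul_pow, inv_mul_cancel₀ hu, one_pow, mul_one]
  rfl

/-- The denominator of the exterior map. -/
def extDenom (R : RatFunc ℂ) : ℂ[X] := conjReflect (ratDegree R) R.num

/-- The numerator of the exterior map. -/
def extNum (R : RatFunc ℂ) : ℂ[X] := conjReflect (ratDegree R) R.denom

theorem eval_extNum_ne_zero (R : RatFunc ℂ) {u : ℂ} (h : (extDenom R).eval u = 0) :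
    (extNum R).eval u ≠ 0 := by
  intro h2
  by_cases hu : u = 0
  · rw [hu, extDenom, eval_zero_conjReflect, map_eq_zero] at h
    rw [hu, extNum, eval_zero_conjReflect, map_eq_zero] at h2
    exact coeff_num_ne_zero R h2 h
  · rw [extDenom, eval_conjReflect (natDegree_num_le R) hu, mul_eq_zero, map_eq_zero] at h
    rw [extNum, eval_conjReflect (natDegree_denom_le R) hu, mul_eq_zero, map_eq_zero] at h2
    have hud : u ^ ratDegree R ≠ 0 := pow_ne_zero _ hu
    exact eval_num_ne_zero R (h2.resolve_left hud) (h.resolve_left hud)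

theorem exteriorMap_coe (R : RatFunc ℂ) (u : ℂ) :
    exteriorMap R (u : OnePoint ℂ) = sphereFrac ((extNum R).eval u) ((extDenom R).eval u) := by
  change inversion (sphereMap R (inversion u)) = _
  by_cases hu : u = 0
  · rw [hu, inversion_zero, sphereMap_infty, inversion_sphereFrac (coeff_num_ne_zero R), extNum,
      extDenom, eval_zero_conjReflect, eval_zero_conjReflect]
  · rw [inversion_coe hu, sphereMap_coe, inversion_sphereFrac (eval_num_ne_zero R), extNum,
      extDenom, eval_conjReflect (natDegree_num_le R) hu,
      eval_conjReflect (natDegree_denom_le R) hu, sphereFrac_mul_left _ _ (pow_ne_zero _ hu)]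

theorem exteriorMap_coe_eq_iff (R : RatFunc ℂ) (u z : ℂ) :
    exteriorMap R (u : OnePoint ℂ) = (z : OnePoint ℂ) ↔
      (extNum R).eval u - z * (extDenom R).eval u = 0 := by
  rw [exteriorMap_coe, sphereFrac_eq_coe_iff fun h => eval_extNum_ne_zero R h]

theorem exteriorMap_eq_iff (R : RatFunc ℂ) (x y : OnePoint ℂ) :
    exteriorMap R x = y ↔ sphereMap R (inversion x) = inversion y := by
  change inversion (sphereMap R (inversion x)) = y ↔ _
  constructor
  · rintro rfl
    rw [inversion_inversion]
  · intro h
    rw [h, inversion_inversion]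

theorem discMap_eq (φ : RatU) (z : 𝔻) :
    φ.1.denom.eval (z : ℂ) ≠ 0 ∧
      (discMap φ z : ℂ) = φ.1.num.eval (z : ℂ) / φ.1.denom.eval (z : ℂ) := by
  have h := discMap_spec φ z
  rw [toSphere, toSphere, sphereMap_coe] at h
  have h0 : φ.1.denom.eval (z : ℂ) ≠ 0 := by
    intro h0
    rw [h0, sphereFrac_zero_right] at h
    exact OnePoint.infty_ne_coe _ h
  rw [sphereFrac_of_ne _ h0] at h
  exact ⟨h0, (OnePoint.coe_injective h).symm⟩

theorem holomorphicOnDisc_discMap (φ : RatU) :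
    HolomorphicOnDisc (fun z => (discMap φ z : ℂ)) :=
  holomorphicOnDisc_of_eq
    (DifferentiableOn.fun_div φ.1.num.differentiableOn φ.1.denom.differentiableOn fun z hz =>
      (discMap_eq φ (Complex.UnitDisc.mk z (mem_ball_zero_iff.1 hz))).1)
    fun z => (discMap_eq φ z).2

theorem norm_num_lt (φ : RatU) (z : 𝔻) :
    ‖φ.1.num.eval (z : ℂ)‖ < ‖φ.1.denom.eval (z : ℂ)‖ := by
  obtain ⟨h0, h⟩ := discMap_eq φ z
  have h1 := (discMap φ z).norm_lt_one
  rwa [h, norm_div, div_lt_one (norm_pos_iff.2 h0)] at h1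

theorem norm_num_le (φ : RatU) {z : ℂ} (hz : ‖z‖ ≤ 1) :
    ‖φ.1.num.eval z‖ ≤ ‖φ.1.denom.eval z‖ := by
  have hcl : z ∈ closure (Metric.ball (0 : ℂ) 1) := by
    rw [closure_ball _ one_ne_zero]
    exact mem_closedBall_zero_iff.2 hz
  exact le_on_closure (fun x hx => (norm_num_lt φ ⟨x, hx⟩).le)
    φ.1.num.continuous.norm.continuousOn φ.1.denom.continuous.norm.continuousOn hcl

/-- The value of the exterior map at `∞` is the inversion of `φ(0)`, which lies outside the closed
disc. Fibres over the closed disc therefore contain only finite points. -/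
theorem exteriorMap_infty_ne (φ : RatU) {z : ℂ} (hz : ‖z‖ ≤ 1) :
    exteriorMap φ.1 OnePoint.infty ≠ (z : OnePoint ℂ) := by
  rw [Ne, exteriorMap_eq_iff, inversion_infty]
  have h := discMap_spec φ 0
  rw [toSphere, Complex.UnitDisc.coe_zero] at h
  rw [h]
  exact (inversion_ne_toSphere hz _).symm

theorem norm_extDenom_le (φ : RatU) {u : ℂ} (hu : 1 ≤ ‖u‖) :
    ‖(extDenom φ.1).eval u‖ ≤ ‖(extNum φ.1).eval u‖ := by
  have h0 : u ≠ 0 := norm_pos_iff.1 (one_pos.trans_le hu)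
  rw [extDenom, extNum, eval_conjReflect (natDegree_num_le _) h0,
    eval_conjReflect (natDegree_denom_le _) h0, norm_mul, norm_mul, RCLike.norm_conj,
    RCLike.norm_conj]
  refine mul_le_mul_of_nonneg_left (norm_num_le φ ?_) (norm_nonneg _)
  rw [norm_div, norm_one, RCLike.norm_conj]
  exact div_le_one_of_le₀ hu (norm_nonneg _)

/-- Inversion sends the closed disc outside the open disc, where every value of `φ` is regular, and
it carries the fibre of the exterior map over `z` bijectively to the fibre of `φ` over the inversion
of `z`. -/
theorem encard_fiber_eq (φ : RatU) (hφ : OuterRegular φ.1) {z : ℂ} (hz : ‖z‖ ≤ 1) :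
    {u | (extNum φ.1).eval u - z * (extDenom φ.1).eval u = 0}.encard = ratDegree φ.1 := by
  have hreg : IsRegularValue φ.1 (inversion (z : OnePoint ℂ)) := by
    by_contra h
    obtain ⟨a, ha⟩ := hφ _ h
    exact inversion_ne_toSphere hz a ha
  have hinj : Function.Injective fun u : ℂ => inversion (u : OnePoint ℂ) :=
    (Function.LeftInverse.injective inversion_inversion).comp OnePoint.coe_injective
  rw [← hinj.encard_image, ← hreg]
  congr 1
  ext x
  constructor
  · rintro ⟨u, hu, rfl⟩
    exact (exteriorMap_eq_iff _ _ _).1 ((exteriorMap_coe_eq_iff _ _ _).2 hu)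
  · intro hx
    obtain ⟨y, rfl⟩ : ∃ y, inversion y = x := ⟨_, inversion_inversion x⟩
    have hy := (exteriorMap_eq_iff _ _ _).2 hx
    induction y using OnePoint.rec with
    | infty => exact absurd hy (exteriorMap_infty_ne φ hz)
    | coe u => exact ⟨u, (exteriorMap_coe_eq_iff _ _ _).1 hy, rfl⟩

theorem regularPair (φ : RatU) (hφ : OuterRegular φ.1) :
    RegularPair (extDenom φ.1) (extNum φ.1) (ratDegree φ.1) where
  natDegree_left := natDegree_conjReflect (natDegree_num_le _)
  natDegree_right := natDegree_conjReflect (natDegree_denom_le _)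
  norm_coeff_lt := by
    rw [extDenom, extNum, coeff_conjReflect, coeff_conjReflect, RCLike.norm_conj, RCLike.norm_conj]
    exact norm_num_lt φ 0
  eval_ne_zero := fun _ h => eval_extNum_ne_zero _ h
  -- For `|u| ≥ 1` one has `|p(u)| ≤ |q(u)|`, so `q(u) = z p(u)` with `|z| < 1` would make `p` and
  -- `q` vanish together.
  sub_ne_zero := fun u hu z hz h0 => by
    have h1 := norm_extDenom_le φ hu
    rw [sub_eq_zero.1 h0, norm_mul] at h1
    by_cases hp : (extDenom φ.1).eval u = 0
    · rw [hp, mul_zero, sub_zero] at h0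
      exact eval_extNum_ne_zero _ hp h0
    · nlinarith [norm_pos_iff.2 hp]
  encard_fiber := fun _ hz => encard_fiber_eq φ hφ hz

/-! ### All branches of the inverse -/

/-- If the preimages of `z` in the disc under `f` are `σ j z`, with `σ j` continuous, open and
pairwise nowhere equal, then the `σ j` are the branches of the inverse of `f`. -/
theorem setOf_isInverseBranch {ι : Type*} {f : OnePoint ℂ → OnePoint ℂ} {σ : ι → 𝔻 → 𝔻}
    (hf : ∀ x z, f x = toSphere z ↔ ∃ j, x = toSphere (σ j z))
    (hinj : ∀ z, Function.Injective fun j => σ j z) (hcont : ∀ j, Continuous (σ j))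
    (hopen : ∀ j, IsOpen (Set.range fun z => (σ j z : ℂ))) :
    {τ : 𝔻 → OnePoint ℂ | IsInverseBranch f τ} = Set.range fun j z => toSphere (σ j z) := by
  have hts : Function.Injective toSphere :=
    OnePoint.coe_injective.comp Complex.UnitDisc.coe_injective
  have htc : Continuous toSphere :=
    OnePoint.continuous_coe.comp Complex.UnitDisc.continuous_coe
  have hfσ : ∀ j z, f (toSphere (σ j z)) = toSphere z := fun j z => (hf _ _).2 ⟨j, rfl⟩
  ext τ
  constructor
  · rintro ⟨V, hV, hVinj, -, hτ⟩
    choose j hj using fun z => (hf (τ z) z).1 (hτ z).2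
    -- No continuity of `τ` is needed: for `y` near `z` both `τ y` and `σ (j z) y` lie in `V` and
    -- have the same image, so injectivity on `V` makes them equal and fixes the index.
    have hloc : IsLocallyConstant j := by
      rw [IsLocallyConstant.iff_eventually_eq]
      intro z
      have hz : toSphere (σ (j z) z) ∈ V := hj z ▸ (hτ z).1
      filter_upwards [(htc.comp (hcont (j z))).continuousAt.preimage_mem_nhds (hV.mem_nhds hz)]
        with y hy
      have := hVinj (hτ y).1 hy ((hτ y).2.trans (hfσ _ _).symm)
      exact hinj y (hts ((hj y).symm.trans this))
    have : PreconnectedSpace 𝔻 :=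
      Subtype.preconnectedSpace (convex_ball (0 : ℂ) 1).isPreconnected
    refine ⟨j 0, ?_⟩
    funext z
    rw [hj z, hloc.apply_eq_of_preconnectedSpace z 0]
  · rintro ⟨j, rfl⟩
    refine ⟨Set.range fun z => toSphere (σ j z), ?_, ?_, ?_, fun z => ⟨⟨z, rfl⟩, hfσ j z⟩⟩
    · have := OnePoint.isOpenEmbedding_coe.isOpenMap _ (hopen j)
      rwa [← Set.range_comp] at this
    · rintro _ ⟨z, rfl⟩ _ ⟨w, rfl⟩ h
      simp only [hfσ] at h
      rw [hts h]
    · rw [← Set.range_comp]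
      exact congrArg Set.range (funext fun z => hfσ j z)

theorem isOpen_range_of_hasDerivAt {F : 𝔻 → ℂ} (h : ∀ z : 𝔻, ∃ c ≠ 0, HasDerivAt (ext F) c z) :
    IsOpen (Set.range F) := by
  have hF : HolomorphicOnDisc F := fun z hz => by
    obtain ⟨c, -, hc⟩ := h ⟨z, hz⟩
    exact hc.differentiableAt.differentiableWithinAt
  rw [isOpen_iff_mem_nhds]
  rintro _ ⟨z, rfl⟩
  have hball : Metric.ball (0 : ℂ) 1 ∈ 𝓝 (z : ℂ) :=
    Metric.isOpen_ball.mem_nhds (mem_ball_zero_iff.2 z.norm_lt_one)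
  have hs := (DifferentiableOn.analyticAt hF hball).hasStrictDerivAt
  obtain ⟨c, hc, hd⟩ := h z
  rw [hd.deriv] at hs
  rw [← ext_coe F z, ← hs.map_nhds_eq hc]
  filter_upwards [image_mem_map hball]
  rintro _ ⟨y, hy, rfl⟩
  exact ⟨⟨y, hy⟩, (ext_coe F ⟨y, hy⟩).symm⟩

end Rational

/-! ### Bounds for the weights and the kernel identities -/

section Adjoint

open Polynomial Filter Topology

theorem HolomorphicOnDisc.discDeriv {F : 𝔻 → ℂ} (hF : HolomorphicOnDisc F) :
    HolomorphicOnDisc (discDeriv F) :=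
  holomorphicOnDisc_of_eq (DifferentiableOn.deriv hF Metric.isOpen_ball) fun _ => rfl

theorem HolomorphicOnDisc.weightH {σ : 𝔻 → 𝔻} (hσ : HolomorphicOnDisc (fun z => (σ z : ℂ))) :
    HolomorphicOnDisc (weightH σ) :=
  HolomorphicOnDisc.mul (holomorphicOnDisc_of_eq differentiableOn_id fun _ => rfl) hσ.discDeriv

theorem HolomorphicOnDisc.inv {F : 𝔻 → ℂ} (hF : HolomorphicOnDisc F) (h0 : ∀ z, F z ≠ 0) :
    HolomorphicOnDisc (fun z => (F z)⁻¹) :=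
  holomorphicOnDisc_of_eq (DifferentiableOn.fun_inv hF fun z hz => by
    rw [ext_of_norm_lt F (mem_ball_zero_iff.1 hz)]
    exact h0 _) fun z => by rw [ext_coe]

theorem weightG_eq (σ : 𝔻 → 𝔻) : weightG σ = fun z => weightH σ z * (σ z : ℂ)⁻¹ :=
  funext fun _ => div_eq_mul_inv _ _

/-- The analytic content of the description of the branches of the inverse of `q / p`. -/
structure IsBranchSystem (p q : ℂ[X]) (d : ℕ) (σ : Fin d → 𝔻 → 𝔻) : Prop where
  injective : ∀ z, Function.Injective fun j => σ j z
  sub_eq_zero_iff : ∀ (z : 𝔻) (u : ℂ), q.eval u - z * p.eval u = 0 ↔ ∃ j, u = σ j z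
  hasDerivAt : ∀ j (z : 𝔻), HasDerivAt (ext fun w => (σ j w : ℂ))
    (p.eval (σ j z : ℂ) / (derivative (fiberPoly p q z)).eval (σ j z : ℂ)) z

namespace IsBranchSystem

variable {p q : ℂ[X]} {d : ℕ} {σ : Fin d → 𝔻 → 𝔻}

theorem sub_eq_zero (hσ : IsBranchSystem p q d σ) (j : Fin d) (z : 𝔻) :
    q.eval (σ j z : ℂ) - z * p.eval (σ j z : ℂ) = 0 := (hσ.sub_eq_zero_iff z _).2 ⟨j, rfl⟩

theorem holomorphic (hσ : IsBranchSystem p q d σ) (j : Fin d) :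
    HolomorphicOnDisc (fun z => (σ j z : ℂ)) := fun z hz =>
  (hσ.hasDerivAt j ⟨z, hz⟩).differentiableAt.differentiableWithinAt

theorem weightH_apply (hσ : IsBranchSystem p q d σ) (j : Fin d) (z : 𝔻) :
    weightH (σ j) z =
      z * (p.eval (σ j z : ℂ) / (derivative (fiberPoly p q z)).eval (σ j z : ℂ)) := by
  rw [weightH, discDeriv, (hσ.hasDerivAt j z).deriv]

theorem continuous (hσ : IsBranchSystem p q d σ) (j : Fin d) : Continuous (σ j) := by
  rw [Complex.UnitDisc.isEmbedding_coe.continuous_iff]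
  have h := (hσ.holomorphic j).continuousOn.comp_continuous Complex.UnitDisc.continuous_coe
    fun z => mem_ball_zero_iff.2 z.norm_lt_one
  exact h.congr fun z => ext_coe _ z

theorem isOpen_range (hσ : IsBranchSystem p q d σ) (h : RegularPair p q d) (j : Fin d) :
    IsOpen (Set.range fun z => (σ j z : ℂ)) := by
  refine isOpen_range_of_hasDerivAt fun z => ⟨_, div_ne_zero (fun hp => ?_) ?_, hσ.hasDerivAt j z⟩
  · have h0 := hσ.sub_eq_zero j z
    rw [hp, mul_zero, sub_zero] at h0
    exact h.eval_ne_zero _ hp h0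
  · exact h.derivative_ne_zero z.norm_lt_one.le (hσ.sub_eq_zero j z)

/-- In `σ' = p(σ) / F_z'(σ)` the denominator is bounded below, because the zeros of `F_z` stay
simple up to `|z| = 1`. -/
theorem boundedHolomorphic_weightH (hσ : IsBranchSystem p q d σ) (h : RegularPair p q d)
    (j : Fin d) : BoundedHolomorphic (weightH (σ j)) := by
  obtain ⟨ε, hε, hle⟩ := h.exists_le_norm
    (g := fun x => (derivative q).eval x.2 - x.1 * (derivative p).eval x.2) (by fun_prop)
    fun z u hz hu => by
      rw [← eval_derivative_fiberPoly]
      exact h.derivative_ne_zero hz hu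
  obtain ⟨K, hK⟩ := (isCompact_closedBall (0 : ℂ) 1).exists_bound_of_continuousOn
    p.continuous.continuousOn
  refine ⟨(hσ.holomorphic j).weightH, K / ε, fun z => ?_⟩
  have hp := hK (σ j z) (mem_closedBall_zero_iff.2 (σ j z).norm_lt_one.le)
  have hd := hle z (σ j z) z.norm_lt_one (hσ.sub_eq_zero j z)
  rw [hσ.weightH_apply, eval_derivative_fiberPoly, norm_mul, norm_div]
  have hK0 : 0 ≤ K := (norm_nonneg _).trans hp
  calc _ ≤ 1 * (K / ε) := by
        gcongr
        exact z.norm_lt_one.le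
    _ = K / ε := one_mul _

/-- The hypothesis `h0` places the value of `q / p` at `0` outside the closed disc, so `0` lies in
no fibre over it. The same compactness argument as for `weightH` then bounds `1 / σ`. -/
theorem ne_zero (hσ : IsBranchSystem p q d σ) (h0 : ‖p.eval 0‖ < ‖q.eval 0‖) (j : Fin d)
    (z : 𝔻) : (σ j z : ℂ) ≠ 0 := by
  intro hz
  have h := hσ.sub_eq_zero j z
  rw [hz] at h
  have h1 := congrArg norm (_root_.sub_eq_zero.1 h)
  rw [norm_mul] at h1
  nlinarith [z.norm_lt_one, norm_nonneg (p.eval 0)]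

theorem boundedHolomorphic_weightG (hσ : IsBranchSystem p q d σ) (h : RegularPair p q d)
    (h0 : ‖p.eval 0‖ < ‖q.eval 0‖) (j : Fin d) : BoundedHolomorphic (weightG (σ j)) := by
  obtain ⟨hH, K, hK⟩ := hσ.boundedHolomorphic_weightH h j
  obtain ⟨ε, hε, hle⟩ := h.exists_le_norm (g := fun x => x.2) continuous_snd
    fun z u hz hu hu0 => by
      change u = 0 at hu0
      rw [hu0] at hu
      have h1 := congrArg norm (_root_.sub_eq_zero.1 hu)
      rw [norm_mul] at h1
      nlinarith [norm_nonneg (p.eval 0)]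
  rw [weightG_eq]
  refine ⟨hH.mul ((hσ.holomorphic j).inv (hσ.ne_zero h0 j)), K / ε, fun z => ?_⟩
  have hd := hle z (σ j z) z.norm_lt_one (hσ.sub_eq_zero j z)
  rw [norm_mul, norm_inv, ← div_eq_mul_inv]
  have hK0 : 0 ≤ K := (norm_nonneg _).trans (hK z)
  gcongr
  exact hK z

/-- This is `z` times the partial fraction expansion of `p / (q - z p)`. As `z p / (q - z p) = q /
(q - z p) - 1`, both at `u` and for the coefficients at degree `d`, the constants cancel. -/
theorem sum_weightH (hσ : IsBranchSystem p q d σ) (h : RegularPair p q d) (z : 𝔻) {u : ℂ}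
    (hu : q.eval u - z * p.eval u ≠ 0) :
    ∑ j, weightH (σ j) z / (u - σ j z) =
      q.eval u / (q.eval u - z * p.eval u) - q.coeff d / (q.coeff d - z * p.coeff d) := by
  have hz := z.norm_lt_one.le
  have hc := h.coeff_fiberPoly_ne_zero hz
  have hs := sum_partialFraction (h.natDegree_fiberPoly z) hc h.natDegree_left
    (v := fun j => (σ j z : ℂ)) (Complex.UnitDisc.coe_injective.comp (hσ.injective z))
    (fun j => by rw [eval_fiberPoly]; exact hσ.sub_eq_zero j z) (u := u)
    (by rw [eval_fiberPoly]; exact hu)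
  rw [RegularPair.coeff_fiberPoly, eval_fiberPoly] at hs
  rw [RegularPair.coeff_fiberPoly] at hc
  have h1 : ∑ j, weightH (σ j) z / (u - σ j z) =
      z * (p.eval u / (q.eval u - z * p.eval u) - p.coeff d / (q.coeff d - z * p.coeff d)) := by
    rw [← hs, Finset.mul_sum]
    refine Finset.sum_congr rfl fun j _ => ?_
    rw [hσ.weightH_apply, mul_div_assoc]
  rw [h1]
  field_simp
  ring

end IsBranchSystem

/-! ### The adjoint of a composition operator with rational symbol -/

theorem one_div_one_sub_div_mul (A z : ℂ) {B : ℂ} (hB : B ≠ 0) :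
    1 / (1 - A / B * z) = B / (B - z * A) := by
  have h : 1 - A / B * z = (B - z * A) / B := by field_simp
  rw [h, one_div_div]

variable (φ : RatU) {σ : Fin (ratDegree φ.1) → 𝔻 → 𝔻}

/-- Kernels at values of `φ` are values of `q / (q - z p)` at the reflected point: here at `∞`, read
off from the coefficients at degree `d`; for `w ≠ 0` at `1 / conj(w)`; for `φ(∞)` at `0`. -/
theorem kernel_discMap_zero (z : 𝔻) :
    kernel (discMap φ 0) z = (extNum φ.1).coeff (ratDegree φ.1) /
      ((extNum φ.1).coeff (ratDegree φ.1) - z * (extDenom φ.1).coeff (ratDegree φ.1)) := by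
  obtain ⟨h0, h⟩ := discMap_eq φ 0
  have h1 : (starRingEnd ℂ) (φ.1.denom.eval 0) ≠ 0 := by simpa using h0
  rw [kernel_apply, h, extNum, extDenom, coeff_conjReflect, coeff_conjReflect,
    Complex.UnitDisc.coe_zero, map_div₀, one_div_one_sub_div_mul _ _ h1]

theorem kernel_discMap {w : 𝔻} (hw : w ≠ 0) (z : 𝔻) :
    kernel (discMap φ w) z = (extNum φ.1).eval (1 / (starRingEnd ℂ) (w : ℂ)) /
      ((extNum φ.1).eval (1 / (starRingEnd ℂ) (w : ℂ)) -
        z * (extDenom φ.1).eval (1 / (starRingEnd ℂ) (w : ℂ))) := by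
  obtain ⟨h0, h⟩ := discMap_eq φ w
  have hw0 : (starRingEnd ℂ) (w : ℂ) ≠ 0 := by simpa using hw
  have hu : 1 / (starRingEnd ℂ) (w : ℂ) ≠ 0 := one_div_ne_zero hw0
  have hud : (1 / (starRingEnd ℂ) (w : ℂ)) ^ ratDegree φ.1 ≠ 0 := pow_ne_zero _ hu
  have hww : 1 / (starRingEnd ℂ) (1 / (starRingEnd ℂ) (w : ℂ)) = w := by simp
  have h1 : (starRingEnd ℂ) (φ.1.denom.eval (w : ℂ)) ≠ 0 := by simpa using h0
  rw [kernel_apply, h, extNum, extDenom, eval_conjReflect (natDegree_num_le _) hu,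
    eval_conjReflect (natDegree_denom_le _) hu, hww, map_div₀, mul_left_comm, ← mul_sub,
    mul_div_mul_left _ _ hud, one_div_one_sub_div_mul _ _ h1]

theorem kernel_of_sphereMap_infty {a : 𝔻} (ha : sphereMap φ.1 OnePoint.infty = toSphere a) :
    ‖(extDenom φ.1).eval 0‖ < ‖(extNum φ.1).eval 0‖ ∧ ∀ z : 𝔻,
      kernel a z = (extNum φ.1).eval 0 / ((extNum φ.1).eval 0 - z * (extDenom φ.1).eval 0) := by
  rw [sphereMap_infty, toSphere] at ha
  have h0 : φ.1.denom.coeff (ratDegree φ.1) ≠ 0 := by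
    intro h0
    rw [h0, sphereFrac_zero_right] at ha
    exact OnePoint.infty_ne_coe _ ha
  have h1 : (starRingEnd ℂ) (φ.1.denom.coeff (ratDegree φ.1)) ≠ 0 := by simpa using h0
  rw [sphereFrac_of_ne _ h0] at ha
  have ha' := OnePoint.coe_injective ha
  rw [extDenom, extNum, eval_zero_conjReflect, eval_zero_conjReflect, RCLike.norm_conj,
    RCLike.norm_conj]
  constructor
  · have hlt := a.norm_lt_one
    rwa [← ha', norm_div, div_lt_one (norm_pos_iff.2 h0)] at hlt
  · intro z
    rw [kernel_apply, ← ha', map_div₀, one_div_one_sub_div_mul _ _ h1]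

variable {φ}

/-- For `w ≠ 0` this is `sum_weightH` at `u = 1 / conj(w)`, since `conj(w) K_w(σ) = 1 / (u - σ)`. -/
theorem sum_weightH_kernel (hφ : OuterRegular φ.1)
    (hσ : IsBranchSystem (extDenom φ.1) (extNum φ.1) (ratDegree φ.1) σ) (w z : 𝔻) :
    ∑ j, weightH (σ j) z * ((starRingEnd ℂ) (w : ℂ) * kernel w (σ j z)) =
      kernel (discMap φ w) z - kernel (discMap φ 0) z := by
  by_cases hw : w = 0
  · simp [hw]
  have h := regularPair φ hφ
  have hw0 : (starRingEnd ℂ) (w : ℂ) ≠ 0 := by simpa using hw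
  have hu : 1 ≤ ‖1 / (starRingEnd ℂ) (w : ℂ)‖ := by
    rw [norm_div, norm_one, RCLike.norm_conj]
    exact (one_le_div (norm_pos_iff.2 (by simpa using hw))).2 w.norm_lt_one.le
  rw [kernel_discMap φ hw, kernel_discMap_zero,
    ← hσ.sum_weightH h z (h.sub_ne_zero _ hu z z.norm_lt_one)]
  refine Finset.sum_congr rfl fun j _ => ?_
  have h1 := one_sub_conj_mul_ne_zero w (σ j z)
  have h2 : 1 / (starRingEnd ℂ) (w : ℂ) - σ j z =
      (1 - (starRingEnd ℂ) (w : ℂ) * σ j z) / (starRingEnd ℂ) (w : ℂ) := by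
    field_simp
  rw [kernel_apply, h2, mul_one_div, div_div_eq_mul_div, mul_div_assoc]

/-- This is `sum_weightH` at `u = 0`, with the sign reversed. -/
theorem sum_weightG (hφ : OuterRegular φ.1)
    (hσ : IsBranchSystem (extDenom φ.1) (extNum φ.1) (ratDegree φ.1) σ) {a : 𝔻}
    (ha : sphereMap φ.1 OnePoint.infty = toSphere a) (z : 𝔻) :
    ∑ j, weightG (σ j) z = kernel (discMap φ 0) z - kernel a z := by
  obtain ⟨hlt, hk⟩ := kernel_of_sphereMap_infty φ ha
  have h0 : (extNum φ.1).eval 0 - z * (extDenom φ.1).eval 0 ≠ 0 := by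
    intro h
    obtain ⟨j, hj⟩ := (hσ.sub_eq_zero_iff z 0).1 h
    exact hσ.ne_zero hlt j z hj.symm
  have h := hσ.sum_weightH (regularPair φ hφ) z h0
  rw [← hk, ← kernel_discMap_zero] at h
  rw [← neg_sub, ← h, ← Finset.sum_neg_distrib]
  refine Finset.sum_congr rfl fun j _ => ?_
  rw [weightG_eq, zero_sub, div_neg, neg_neg, div_eq_mul_inv]

/-- The sum of the two preceding identities, by `1 / (σ (1 - conj(w) σ)) = 1 / σ + conj(w) / (1 -
conj(w) σ)`; the terms `K_{φ(0)}` cancel. -/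
theorem sum_weightG_kernel (hφ : OuterRegular φ.1)
    (hσ : IsBranchSystem (extDenom φ.1) (extNum φ.1) (ratDegree φ.1) σ) {a : 𝔻}
    (ha : sphereMap φ.1 OnePoint.infty = toSphere a) (w z : 𝔻) :
    ∑ j, weightG (σ j) z * kernel w (σ j z) = kernel (discMap φ w) z - kernel a z := by
  have h1 := sum_weightH_kernel hφ hσ w z
  have h2 := sum_weightG hφ hσ ha z
  rw [← sub_add_sub_cancel _ (kernel (discMap φ 0) z), ← h1, ← h2, ← Finset.sum_add_distrib]
  refine Finset.sum_congr rfl fun j _ => ?_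
  have h3 := one_sub_conj_mul_ne_zero w (σ j z)
  have h4 := hσ.ne_zero (kernel_of_sphereMap_infty φ ha).1 j z
  rw [weightG_eq, kernel_apply]
  obtain ⟨D, hD⟩ : ∃ D, D = 1 - (starRingEnd ℂ) (w : ℂ) * (σ j z : ℂ) := ⟨_, rfl⟩
  rw [← hD] at h3 ⊢
  field_simp
  rw [hD]
  ring

end Adjoint

end RatComp

end

open RatComp in
theorem theorem4p2 (φ : RatU) (hφ : OuterRegular φ.1) :
    ∃ σ : Fin (ratDegree φ.1) → 𝔻 → 𝔻,
      -- the `σ j` are distinct, and they are all the branches on the disc of the inverse of `φ_e`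
      Function.Injective σ ∧
      {τ : 𝔻 → OnePoint ℂ | IsInverseBranch (exteriorMap φ.1) τ} =
        Set.range (fun j z => toSphere (σ j z)) ∧
      (∀ j, HolomorphicOnDisc (fun z => (σ j z : ℂ))) ∧
      -- part (a)
      (∀ j, BoundedHolomorphic (weightH (σ j))) ∧
      (∃ (C_φ Λ₀ B : H2 →L[ℂ] H2) (M C : Fin (ratDegree φ.1) → H2 →L[ℂ] H2),
        Realizes (compOp (discMap φ)) C_φ ∧
        Realizes (rankOne (discMap φ 0)) Λ₀ ∧
        Realizes backwardShift B ∧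
        (∀ j, Realizes (mulOp (weightH (σ j))) (M j)) ∧
        (∀ j, Realizes (compOp (σ j)) (C j)) ∧
        ContinuousLinearMap.adjoint C_φ = Λ₀ + ∑ j, M j ∘L C j ∘L B) ∧
      -- part (b)
      (∀ a : 𝔻, sphereMap φ.1 OnePoint.infty = toSphere a →
        (∀ j z, (σ j z : ℂ) ≠ 0) ∧
        (∀ j, BoundedHolomorphic (weightG (σ j))) ∧
        ∃ (C_φ Λ_inf : H2 →L[ℂ] H2) (M C : Fin (ratDegree φ.1) → H2 →L[ℂ] H2),
          Realizes (compOp (discMap φ)) C_φ ∧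
          Realizes (rankOne a) Λ_inf ∧
          (∀ j, Realizes (mulOp (weightG (σ j))) (M j)) ∧
          (∀ j, Realizes (compOp (σ j)) (C j)) ∧
          ContinuousLinearMap.adjoint C_φ = Λ_inf + ∑ j, M j ∘L C j) := by

  have h := regularPair φ hφ
  obtain ⟨σ, h1, h2, h3⟩ := h.exists_branches
  have hσ : IsBranchSystem _ _ _ σ := ⟨h1, h2, h3⟩
  obtain ⟨Cφ, hCφ⟩ := exists_realizes_compOp (holomorphicOnDisc_discMap φ)
  obtain ⟨Λ₀, hΛ₀⟩ := exists_realizes_rankOne (discMap φ 0)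
  obtain ⟨B, hB⟩ := exists_realizes_backwardShift
  choose C hC using fun j => exists_realizes_compOp (hσ.holomorphic j)
  choose M hM using fun j => exists_realizes_mulOp (hσ.boundedHolomorphic_weightH h j)
  have hrank : ∀ (a w z : 𝔻), rankOne a (kernel w) z = kernel a z := fun a w z => by
    simp [rankOne, kernel_apply]
  refine ⟨σ, fun i j hij => h1 0 (congrFun hij 0), ?_, hσ.holomorphic,
    hσ.boundedHolomorphic_weightH h, ⟨Cφ, Λ₀, B, M, C, hCφ, hΛ₀, hB, hM, hC, ?_⟩,
    fun a ha => ?_⟩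
  · refine setOf_isInverseBranch (fun x z => ?_) h1 hσ.continuous (hσ.isOpen_range h)
    induction x using OnePoint.rec with
    | infty =>
      refine iff_of_false (exteriorMap_infty_ne φ z.norm_lt_one.le) ?_
      rintro ⟨j, hj⟩
      exact OnePoint.infty_ne_coe _ hj
    | coe u =>
      rw [toSphere, exteriorMap_coe_eq_iff, h2]
      simp only [toSphere, OnePoint.coe_eq_coe]
  -- On `K_w` the rank-one term gives `K_{φ(0)}`, and the sum over the branches must supply
  -- `K_{φ(w)} - K_{φ(0)}`.
  · refine adjoint_eq_of_kernel hCφ fun w z => ?_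
    rw [_root_.add_apply, _root_.sum_apply, H2.add_apply, H2.sum_apply,
      hΛ₀, hrank]
    refine eq_sub_iff_add_eq'.1 (Eq.trans ?_ (sum_weightH_kernel hφ hσ w z))
    refine Finset.sum_congr rfl fun j _ => ?_
    rw [ContinuousLinearMap.comp_apply, ContinuousLinearMap.comp_apply, hM, mulOp, hC, compOp, hB,
      backwardShift_kernel]
  · have hlt := (kernel_of_sphereMap_infty φ ha).1
    obtain ⟨Λ, hΛ⟩ := exists_realizes_rankOne a
    choose N hN using fun j => exists_realizes_mulOp (hσ.boundedHolomorphic_weightG h hlt j)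
    refine ⟨hσ.ne_zero hlt, hσ.boundedHolomorphic_weightG h hlt,
      Cφ, Λ, N, C, hCφ, hΛ, hN, hC, adjoint_eq_of_kernel hCφ fun w z => ?_⟩
    rw [_root_.add_apply, _root_.sum_apply, H2.add_apply, H2.sum_apply,
      hΛ, hrank]
    refine eq_sub_iff_add_eq'.1 (Eq.trans ?_ (sum_weightG_kernel hφ hσ ha w z))
    refine Finset.sum_congr rfl fun j _ => ?_
    rw [ContinuousLinearMap.comp_apply, hN, mulOp, hC, compOp]
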